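/- **Theorem 9 (maxpoints, $\mathbb{Z}^n$).** There is an absolute constant $C>0$ such that the following holds. Let $p_1,\dots,p_N$ be $N\ge 2$ distinct points of $\mathbb{Z}^n$ whose coordinates are bounded in absolute value by an integer $U\ge 2$, and let $0<\epsilon\le\frac12$. Then the quantum algorithm *maxpoints* described below, run on these points, returns, with probability of failure at most $\epsilon$, a straight line of $\mathbb{R}^n$ on which lies the maximum number of the given points (no straight line contains more of them), and its expected running time is at most $C\,N^{3/2}\,n\,\lg U\,\sqrt{\lg\epsilon^{-1}}$, that is, $O(N^{3/2}n\lg U\sqrt{\lg\epsilon^{-1}})$, where $\lg=\log_2$. *Algorithm.* For a point $p$, the function $mup(p)$ starts with an empty table $H$ that maps vectors of $\mathbb{Z}^n$ to integers. For each of the other points $p_i$ it forms $\vec a=p_i-p$ and normalizes it, by Euclid's algorithm, to the parallel integer vector whose first nonzero component is positive and whose components have greatest common divisor $1$; it inserts the normalized vector in $H$ with value $1$ if it is not there yet, and otherwise increments its value. It returns the maximum value in $H$. The algorithm *maxpoints* uses *minfind* with parameter $\epsilon^{-1}$ to maximize $mup$ over the given points; it calls the result $P$, takes a key $\vec V$ with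 the maximum value in the table of $P$, and returns the line $\vec X(t)=P+t\vec V$. *Subroutines*, for a domain of size $N$. *Minfind*, for a function $F$: pick $y$ uniformly at random; then repeatedly run *findsol* to find $y'$ with $F(y')<F(y)$ and set $y=y'$; when *findsol* returns nothing, return $y$. *Findsol*, for a predicate: run *BBHT* up to two times, then *BCWZ* with parameter $\epsilon^{-1}$, and return the first solution found. *BBHT*: for $m=1,\lambda,\lambda^2,\dots$ with $\lambda=8/7$, while $m\le2\sqrt N$, run Grover's algorithm with a uniformly random number $0\le j<m$ of iterations, until the measured element is a solution. *BCWZ*: with $t_0=\lceil\lg\epsilon^{-1}\rceil$, run, until a solution is found, exact Grover searches that assume $t=1,\dots,\min(t_0,N)$ solutions, and then, if $t_0<N$, $3t_0$ Grover searches, each with a uniformly random number $0\le j<\lceil\sqrt{N/t_0}\,\rceil$ of iterations. *Running time.* Each basic arithmetic, comparison or addressing operation takes constant time; an access to $H$ takes time proportional to the number of binary digits of the key (with its signs and separators). The table is addressed by the digits of the key, and its maximum is found by a walk over its cells. A Grover iteration for a predicate $f$ takes twice the maximum, over all inputs, of the running time of $f$, plus time proportional to the number of qubits of the register. -/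

import Mathlib

namespace Maxpoints

/-! ## Deterministic computations with a step count

Cost model: unit cost for each basic arithmetic, comparison or addressing operation, and for each
memory cell that is visited.  All integers that occur below have absolute value at most twice the
largest input coordinate. -/

/-- The result of a deterministic classical computation together with the number of steps. -/
structure Timed (α : Type) where
  val : α
  time : ℕ

instance : Monad Timed where
  pure a := ⟨a, 0⟩
  bind c f := ⟨(f c.val).val, c.time + (f c.val).time⟩

/-- Spend `k` steps. -/
def tick (k : ℕ) : Timed Unit := ⟨(), k⟩

/-! ## The classical part: directions, table of directions, and the function `mup` -/

/-- Euclid's algorithm; each division step (with its test for zero) takes two steps. -/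
def euclid (a b : ℕ) : Timed ℕ :=
  if b = 0 then do
    tick 1
    return a
  else do
    tick 2
    euclid b (a % b)
termination_by b
decreasing_by exact Nat.mod_lt _ (by omega)

/-- The gcd of the absolute values of the components, by one call to Euclid per component. -/
def gcdComponents {n : ℕ} (a : Fin n → ℤ) : Timed ℕ :=
  (List.finRange n).foldlM
    (fun g k => do
      tick 1
      euclid g (a k).natAbs) 0

/-- The sign of the first nonzero component (`0` for the zero vector). -/
def leadingSign {n : ℕ} (a : Fin n → ℤ) : Timed ℤ :=
  (List.finRange n).foldlM
    (fun s k => do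
      tick 2
      return if s = 0 then (a k).sign else s) 0

/-- The integer vector parallel to `a` whose first nonzero component is positive and whose
components have gcd one (for `a ≠ 0`). -/
def normalizeVec {n : ℕ} (a : Fin n → ℤ) : Timed (Fin n → ℤ) := do
  let g ← gcdComponents a
  let s ← leadingSign a
  tick (2 * n)
  return fun k => s * (a k / (g : ℤ))

/-- The table `H`, mapping keys in `ℤⁿ` to integers.  The table is addressed by the digits of the
key: a cell is reached by following the symbols of the key's address, and it holds either nothing or
a key with its value.  (This takes the place of a hash function, so that there are no collisions,
and the cost of an access is the length of the address, in the worst case.) -/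
inductive Table (n : ℕ) : Type where
  | empty : Table n
  | node (entry : Option ((Fin n → ℤ) × ℕ)) (next : Option Bool → Table n) : Table n

namespace Table

/-- The content of the root cell. -/
def entry {n : ℕ} : Table n → Option ((Fin n → ℤ) × ℕ)
  | empty => none
  | node e _ => e

/-- The subtables below the root cell. -/
def next {n : ℕ} : Table n → Option Bool → Table n
  | empty => fun _ => empty
  | node _ c => c

/-- The address of one integer: its sign, its binary digits, and a separator. -/
def addressInt (z : ℤ) : List (Option Bool) :=
  some (decide (z < 0)) :: (z.natAbs.bits.map some ++ [none])

/-- The address of a key, one step per symbol. -/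
def address {n : ℕ} (v : Fin n → ℤ) : Timed (List (Option Bool)) := do
  let w := (List.finRange n).flatMap fun k => addressInt (v k)
  tick w.length
  return w

/-- Update the cell with the given address: if the key is not yet there, insert it with value `1`;
otherwise increment its value. -/
def incrementAt {n : ℕ} (v : Fin n → ℤ) : Table n → List (Option Bool) → Timed (Table n)
  | H, [] => do
    tick 2
    match H.entry with
    | none => return node (some (v, 1)) H.next
    | some (w, c) => return node (some (w, c + 1)) H.next
  | H, s :: w => do
    tick 1
    let K ← incrementAt v (H.next s) w
    return node H.entry (Function.update H.next s K)

/-- If `v` is not yet in the table, insert it with value `1`; otherwise increment its value. -/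
def increment {n : ℕ} (H : Table n) (v : Fin n → ℤ) : Timed (Table n) := do
  let w ← address v
  incrementAt v H w

/-- The one of two optional entries that has the larger value. -/
def larger {n : ℕ} : Option ((Fin n → ℤ) × ℕ) → Option ((Fin n → ℤ) × ℕ) →
    Option ((Fin n → ℤ) × ℕ)
  | none, e => e
  | e, none => e
  | some e, some e' => if e.2 < e'.2 then some e' else some e

/-- A table entry with the maximum value, by a walk over all cells. -/
def findMax {n : ℕ} : Table n → Timed (Option ((Fin n → ℤ) × ℕ))
  | empty => do
    tick 1
    return none
  | node e c => do
    let e₁ ← findMax (c none)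
    let e₂ ← findMax (c (some false))
    let e₃ ← findMax (c (some true))
    tick 4
    return larger e (larger e₁ (larger e₂ e₃))

end Table

/-- The table of the normalized vectors from the point `p P` to all the other points, each with the
number of times that it occurs. -/
def directionTable {N n : ℕ} (p : Fin N → Fin n → ℤ) (P : Fin N) : Timed (Table n) :=
  (List.finRange N).foldlM
    (fun H i => do
      tick 1
      if i = P then return H
      else do
        tick (3 * n)
        let a ← normalizeVec (fun k => p i k - p P k)
        H.increment a)
    Table.empty

/-- The maximum value in the table of directions from `p P`: the number of other points on the best
line through `p P`. -/
def mup {N n : ℕ} (p : Fin N → Fin n → ℤ) (P : Fin N) : Timed ℕ := do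
  let H ← directionTable p P
  let e ← H.findMax
  tick 1
  return (e.map Prod.snd).getD 0

/-- A key with the maximum value in the table of directions from `p P`. -/
def mupKey {N n : ℕ} (p : Fin N → Fin n → ℤ) (P : Fin N) : Timed (Fin n → ℤ) := do
  let H ← directionTable p P
  let e ← H.findMax
  tick n
  return (e.map Prod.fst).getD 0

noncomputable section

/-! ## Computations with quantum subroutines and measurements -/

/-- A computation whose outcome and running time are random: the joint law of the two. -/
def RandTimed (α : Type) : Type := PMF (α × ℕ)

instance : Monad RandTimed where
  pure a := PMF.pure (a, 0)
  bind c f := PMF.bind c fun o => PMF.map (fun o' => (o'.1, o.2 + o'.2)) (f o.1)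

/-- A deterministic computation as a random one. -/
def run {α : Type} (c : Timed α) : RandTimed α := PMF.pure (c.val, c.time)

/-- The probability that the outcome does not satisfy `S`. -/
def failureProbability {α : Type} (c : RandTimed α) (S : α → Prop) : ENNReal :=
  PMF.toOuterMeasure c {o | ¬ S o.1}

/-- The expected running time. -/
def expectedTime {α : Type} (c : RandTimed α) : ENNReal :=
  ∑' o : α × ℕ, (show PMF (α × ℕ) from c) o * (o.2 : ENNReal)

/-- Pure states of a quantum register with basis `ι`. -/
abbrev QState (ι : Type) [Fintype ι] : Type := Metric.sphere (0 : EuclideanSpace ℂ ι) 1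

/-- The number of qubits of a register with basis `ι`, plus one: the time to prepare one of the
initial states below, or to measure the register. -/
def registerCost (ι : Type) [Fintype ι] : ℕ := Nat.clog 2 (Fintype.card ι) + 1

/-- Measurement in the standard basis: the outcome `x` has probability `|⟨x|ψ⟩|²`. -/
def measure {ι : Type} [Fintype ι] (ψ : QState ι) : PMF ι :=
  PMF.ofFintype (fun x => ENNReal.ofReal (‖ψ.1 x‖ ^ 2)) (by
    have h : ‖ψ.1‖ = 1 := mem_sphere_zero_iff_norm.mp ψ.2
    rw [← ENNReal.ofReal_sum_of_nonneg (fun _ _ => by positivity),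
      ← EuclideanSpace.norm_sq_eq, h]
    simp)

/-- A unitary transformation, applied to a state. -/
def applyGate {ι : Type} [Fintype ι]
    (A : EuclideanSpace ℂ ι ≃ₗᵢ[ℂ] EuclideanSpace ℂ ι) (ψ : QState ι) : QState ι :=
  ⟨A ψ.1, by
    have h : ‖ψ.1‖ = 1 := mem_sphere_zero_iff_norm.mp ψ.2
    simp [h]⟩

/-- The phase oracle of `χ`: `|x⟩ ↦ -|x⟩` if `χ x`, and `|x⟩ ↦ |x⟩` otherwise. -/
def phaseOracle {ι : Type} [Fintype ι] (χ : ι → Bool) :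
    EuclideanSpace ℂ ι ≃ₗᵢ[ℂ] EuclideanSpace ℂ ι :=
  LinearIsometryEquiv.piLpCongrRight 2 fun x =>
    if χ x then LinearIsometryEquiv.neg ℂ else LinearIsometryEquiv.refl ℂ ℂ

/-- The diffusion operator `2|ψ⟩⟨ψ| - 1`. -/
def diffusion {ι : Type} [Fintype ι] (ψ : QState ι) :
    EuclideanSpace ℂ ι ≃ₗᵢ[ℂ] EuclideanSpace ℂ ι :=
  (Submodule.span ℂ {ψ.1}).reflection

/-- The state after `j` Grover iterations for `χ` from the initial state `ψ`. -/
def groverState {ι : Type} [Fintype ι] (ψ : QState ι) (χ : ι → Bool) (j : ℕ) : QState ι :=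
  (fun φ => applyGate (diffusion ψ) (applyGate (phaseOracle χ) φ))^[j] ψ

/-- The worst-case running time of `f`: the time to run `f` on a superposition of inputs. -/
def worstTime {ι α : Type} [Fintype ι] (f : ι → Timed α) : ℕ :=
  Finset.univ.sup fun x => (f x).time

/-- Prepare `ψ`, apply `j` Grover iterations for `f`, and measure.  In each iteration `f` is
computed and uncomputed around a phase flip, and `ψ` is unprepared and prepared again around a
reflection about the all-zero basis state. -/
def groverMeasure {ι : Type} [Fintype ι] (ψ : QState ι) (f : ι → Timed Bool) (j : ℕ) :
    RandTimed ι :=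
  PMF.map
    (fun x => (x, 2 * registerCost ι + j * (2 * worstTime f + 1 + 3 * registerCost ι)))
    (measure (groverState ψ (fun x => (f x).val) j))

/-- The state `|D|^{-1/2} ∑ₓ |x⟩ ⊗ (cos β |0⟩ + sin β |1⟩)`. -/
def ancillaState (D : Type) [Fintype D] [Nonempty D] (β : ℝ) : QState (D × Bool) :=
  ⟨WithLp.toLp 2 fun x =>
      (((Real.sqrt (Fintype.card D))⁻¹ * (if x.2 then Real.sin β else Real.cos β) : ℝ) : ℂ), by
    have hD : (0 : ℝ) < Fintype.card D := by exact_mod_cast Fintype.card_pos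
    rw [mem_sphere_zero_iff_norm, ← sq_eq_sq₀ (norm_nonneg _) zero_le_one,
      EuclideanSpace.norm_sq_eq, Fintype.sum_prod_type]
    simp only [Complex.norm_real, Real.norm_eq_abs, sq_abs, mul_pow, inv_pow,
      Real.sq_sqrt hD.le, Fintype.sum_bool, if_true, Bool.false_eq_true, if_false,
      ← mul_add, Real.sin_sq_add_cos_sq]
    simp [hD.ne']⟩

/-- The uniform superposition `|D|^{-1/2} ∑ₓ |x⟩`. -/
def uniformState (D : Type) [Fintype D] [Nonempty D] : QState D :=
  ⟨WithLp.toLp 2 fun _ => (((Real.sqrt (Fintype.card D))⁻¹ : ℝ) : ℂ), by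
    have hD : (0 : ℝ) < Fintype.card D := by exact_mod_cast Fintype.card_pos
    rw [mem_sphere_zero_iff_norm, ← sq_eq_sq₀ (norm_nonneg _) zero_le_one,
      EuclideanSpace.norm_sq_eq]
    simp only [Complex.norm_real, Real.norm_eq_abs, sq_abs, inv_pow, Real.sq_sqrt hD.le]
    simp [hD.ne']⟩

/-! ## Quantum search -/

/-- A uniformly random element of a finite domain. -/
def randomElement (D : Type) [Fintype D] [Nonempty D] : RandTimed D :=
  PMF.map (fun x => (x, registerCost D)) (PMF.uniformOfFintype D)

/-- A uniformly random integer `0 ≤ j < k` (for `0 < k`). -/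
def randomBelow : ℕ → RandTimed ℕ
  | 0 => pure 0
  | k + 1 => do
    let j ← randomElement (Fin (k + 1))
    return j

/-- Run the given searches one after the other until one of them returns a result. -/
def firstSuccess {α : Type} : List (RandTimed (Option α)) → RandTimed (Option α)
  | [] => pure none
  | c :: cs => do
    match ← c with
    | some a => return some a
    | none => firstSuccess cs

/-- Grover's algorithm with `j` iterations: the outcome is returned if it is a solution. -/
def grover {D : Type} [Fintype D] [Nonempty D] (f : D → Timed Bool) (j : ℕ) :
    RandTimed (Option D) := do
  let x ← groverMeasure (uniformState D) f j
  let b ← run (f x)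
  return if b then some x else none

/-- Grover's algorithm with a random number `0 ≤ j < m` of iterations. -/
def groverRandom {D : Type} [Fintype D] [Nonempty D] (f : D → Timed Bool) (m : ℝ) :
    RandTimed (Option D) := do
  let j ← randomBelow ⌈m⌉₊
  grover f j

/-- The algorithm *BBHT*: `groverRandom` for `m = 1, λ, λ², …` with `λ = 8/7`, as long as
`m ≤ 2 √|D|` and no solution has been found. -/
def bbht {D : Type} [Fintype D] [Nonempty D] (f : D → Timed Bool) : RandTimed (Option D) :=
  firstSuccess
    ((List.range (⌊Real.logb (8 / 7) (2 * Real.sqrt (Fintype.card D))⌋₊ + 1)).map fun s =>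
      groverRandom f ((8 / 7 : ℝ) ^ s))

/-- The number of iterations of the exact search for `t` solutions among `N` elements. -/
def exactIterations (N t : ℕ) : ℕ :=
  ⌈Real.pi / (4 * Real.arcsin (Real.sqrt (t / N))) - 1 / 2⌉₊

/-- The angle of the auxiliary qubit of the exact search for `t` solutions among `N` elements: it
lowers the initial success amplitude from `√(t/N)` to `sin (π / (4 m + 2))`, where `m` is the number
of iterations. -/
def exactAngle (N t : ℕ) : ℝ :=
  Real.arcsin (Real.sqrt (N / t) * Real.sin (Real.pi / (4 * exactIterations N t + 2)))

/-- Exact Grover search under the assumption that there are `t` solutions: a marked basis state is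
a solution with auxiliary qubit `1`. -/
def groverExact {D : Type} [Fintype D] [Nonempty D] (f : D → Timed Bool) (t : ℕ) :
    RandTimed (Option D) := do
  let x ← groverMeasure (ancillaState D (exactAngle (Fintype.card D) t))
    (fun x : D × Bool => do
      let b ← f x.1
      tick 1
      return b && x.2)
    (exactIterations (Fintype.card D) t)
  let b ← run (f x.1)
  return if b then some x.1 else none

/-- The algorithm *BCWZ* with parameter `ε⁻¹`: with `t₀ = ⌈lg ε⁻¹⌉`, exact searches for
`t = 1, …, min t₀ |D|` solutions; if all fail and `t₀ < |D|`, then `3 t₀` searches with less than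
`√(|D|/t₀)` (rounded up) iterations each. -/
def bcwz {D : Type} [Fintype D] [Nonempty D] (ε : ℝ) (f : D → Timed Bool) :
    RandTimed (Option D) :=
  let t₀ : ℕ := ⌈Real.logb 2 ε⁻¹⌉₊
  firstSuccess
    ((List.range (min t₀ (Fintype.card D))).map (fun t => groverExact f (t + 1)) ++
      if t₀ < Fintype.card D then
        List.replicate (3 * t₀) (groverRandom f (Real.sqrt (Fintype.card D / t₀)))
      else [])

/-- The algorithm *findsol*: run *BBHT* up to two times, and then *BCWZ* with parameter `ε⁻¹`. -/
def findsol {D : Type} [Fintype D] [Nonempty D] (ε : ℝ) (f : D → Timed Bool) :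
    RandTimed (Option D) :=
  firstSuccess [bbht f, bbht f, bcwz ε f]

/-- The loop of *minfind*: use *findsol* to replace `y` by an element with a smaller value of `F`,
until *findsol* returns nothing.  The first argument bounds the number of rounds. -/
def minfindLoop {D : Type} [Fintype D] [Nonempty D] (ε : ℝ) (F : D → Timed ℤ) :
    ℕ → D → RandTimed D
  | 0, y => return y
  | k + 1, y => do
    let v ← run (F y)
    let r ← findsol ε fun x => do
      let w ← F x
      tick 1
      return decide (w < v)
    match r with
    | some y' => minfindLoop ε F k y'
    | none => return y

/-- The algorithm *minfind* with parameter `ε⁻¹`: start the loop at a uniformly random element.  The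
values strictly decrease, so the loop ends by itself after at most `|D|` rounds. -/
def minfind {D : Type} [Fintype D] [Nonempty D] (ε : ℝ) (F : D → Timed ℤ) : RandTimed D := do
  let y ← randomElement D
  minfindLoop ε F (Fintype.card D) y

/-! ## The algorithm *maxpoints* -/

/-- The algorithm *maxpoints*: let *minfind* maximize `mup` over all points, and let `P` be the
result; return the point `P` and a most frequent direction `V` from `P`, which stand for the line
`X(t) = P + t V`. -/
def maxpoints {N n : ℕ} [NeZero N] (ε : ℝ) (p : Fin N → Fin n → ℤ) :
    RandTimed ((Fin n → ℤ) × (Fin n → ℤ)) := do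
  let P ← minfind ε fun i => do
    let c ← mup p i
    tick 1
    return -(c : ℤ)
  let V ← run (mupKey p P)
  run (tick n)
  return (p P, V)

/-! ## Lines and points on them -/

/-- An integer point as a point of real space. -/
def toReal {n : ℕ} (v : Fin n → ℤ) : Fin n → ℝ := fun k => (v k : ℝ)

/-- Straight lines in `ℝⁿ`. -/
def IsLine {n : ℕ} (L : AffineSubspace ℝ (Fin n → ℝ)) : Prop :=
  (L : Set (Fin n → ℝ)).Nonempty ∧ Module.finrank ℝ L.direction = 1

/-- The number of the given points that lie on `L`. -/
def pointsOn {N n : ℕ} (p : Fin N → Fin n → ℤ) (L : AffineSubspace ℝ (Fin n → ℝ)) : ℕ :=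
  Set.ncard {i : Fin N | toReal (p i) ∈ L}

/-- The set of all `P + t V` with `t` real. -/
def lineOf {n : ℕ} (P V : Fin n → ℤ) : AffineSubspace ℝ (Fin n → ℝ) :=
  AffineSubspace.mk' (toReal P) (Submodule.span ℝ {toReal V})

/-- `L` is a straight line on which lies the maximum number of the given points. -/
def IsMaxLine {N n : ℕ} (p : Fin N → Fin n → ℤ) (L : AffineSubspace ℝ (Fin n → ℝ)) : Prop :=
  IsLine L ∧ ∀ L' : AffineSubspace ℝ (Fin n → ℝ), IsLine L' → pointsOn p L' ≤ pointsOn p L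

end

end Maxpoints

/-! Geometry. On a line through a given point `Q`, all other given points have the same normalized
direction from `Q` (`dir_eq_of_mem_line`), so a line with at least two given points carries at most
`mup Q + 1` of them for some `Q` on it. Conversely `P + tV` carries at least `mup P + 1` points
(`pointsOn_lineOf_ge`). Hence the answer is right whenever *minfind* returns a true minimizer of
`-mup`, and the rest is an analysis of *minfind*.

Grover amplitudes depend on a basis state only through its mark and its initial amplitude
(`groverState_apply`). Every search is therefore unbiased: it finds all solutions with equal
probability. If `t` elements lie strictly below `y`, each of them is the next element with
probability at most `1/t`, and a monotone function of their ranks has at most the sum that it has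
over `0, …, t - 1` (`sum_prob_findsol_mul_le`). Both claims about *minfind* then follow by bounding
a potential in `t`. Write `t₀ = ⌈lg ε⁻¹⌉` and `N` for the size of the domain.

Failure: the potential is `0` for `t ≤ t₀` and `ε` otherwise. One of the exact searches succeeds
with certainty when `0 < t ≤ t₀`. For `t > t₀` a round misses with probability at most `ε/t`, namely
`1/t` from *BBHT* times `ε` from *BCWZ*; since rank `0` contributes nothing, the later rounds fail
with probability at most `(t - 1)ε/t`. The sum is `ε`.

Time: a round with `t > 0` solutions costs `O(√(N t₀ / t))` evaluations of the predicate, and the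
last one, with `t = 0`, costs `O(√(N t₀))`. The potential `3 - 1/√t` (and `1` at `t = 0`) absorbs
this, because its mean over `0, …, t - 1` is at most `3 - 2/√t`. So *minfind* needs `O(√(N t₀))`
evaluations of `mup`, each costing `O(N n lg U)`: Euclid's algorithm, table accesses and the walk
over the cells are all linear in the number of digits. -/

namespace Maxpoints

open scoped ENNReal

/-! ## Expectations of random timed computations -/

/-- The joint law of the outcome and the running time. -/
def law {α : Type} (c : RandTimed α) : PMF (α × ℕ) := c

/-- The expectation of a function of the outcome. -/
noncomputable def expect {α : Type} (c : RandTimed α) (g : α → ℝ≥0∞) : ℝ≥0∞ :=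
  ∑' o : α × ℕ, law c o * g o.1

theorem expectedTime_eq {α : Type} (c : RandTimed α) :
    expectedTime c = ∑' o : α × ℕ, law c o * (o.2 : ℝ≥0∞) := rfl

theorem tsum_bind_mul {α β : Type} (c : PMF α) (f : α → PMF β) (g : β → ℝ≥0∞) :
    ∑' b, (c.bind f) b * g b = ∑' a, c a * ∑' b, f a b * g b := by
  simp_rw [PMF.bind_apply, ← ENNReal.tsum_mul_right, ← ENNReal.tsum_mul_left]
  rw [ENNReal.tsum_comm]
  simp_rw [mul_assoc]

theorem tsum_pure_mul {α : Type} (a : α) (g : α → ℝ≥0∞) :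
    ∑' b, (PMF.pure a) b * g b = g a := by
  rw [tsum_eq_single a]
  · simp
  · intro b hb
    simp [PMF.pure_apply, hb]

theorem tsum_map_mul {α β : Type} (c : PMF α) (f : α → β) (g : β → ℝ≥0∞) :
    ∑' b, (c.map f) b * g b = ∑' a, c a * g (f a) := by
  rw [PMF.map, tsum_bind_mul]
  refine tsum_congr fun a => ?_
  rw [Function.comp_apply, tsum_pure_mul]

theorem expect_pure {α : Type} (a : α) (g : α → ℝ≥0∞) :
    expect (pure a : RandTimed α) g = g a :=
  tsum_pure_mul (a, 0) fun o => g o.1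

theorem expectedTime_pure {α : Type} (a : α) :
    expectedTime (pure a : RandTimed α) = 0 := by
  refine (tsum_pure_mul (a, 0) fun o : α × ℕ => (o.2 : ℝ≥0∞)).trans ?_
  simp

theorem expect_run {α : Type} (c : Timed α) (g : α → ℝ≥0∞) :
    expect (run c) g = g c.val :=
  tsum_pure_mul (c.val, c.time) fun o => g o.1

theorem expectedTime_run {α : Type} (c : Timed α) :
    expectedTime (run c) = c.time :=
  tsum_pure_mul (c.val, c.time) fun o : α × ℕ => (o.2 : ℝ≥0∞)

theorem expect_bind {α β : Type} (c : RandTimed α) (f : α → RandTimed β) (g : β → ℝ≥0∞) :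
    expect (c >>= f) g = expect c fun a => expect (f a) g := by
  refine (tsum_bind_mul _ _ _).trans (tsum_congr fun o => ?_)
  congr 1
  exact tsum_map_mul _ _ _

/-- The times add, and the law of the continuation has total mass one, so the time already spent
factors out. -/
theorem expectedTime_bind {α β : Type} (c : RandTimed α) (f : α → RandTimed β) :
    expectedTime (c >>= f) = expectedTime c + expect c fun a => expectedTime (f a) := by
  rw [expectedTime_eq c, expect, ← ENNReal.tsum_add]
  refine (tsum_bind_mul _ _ _).trans (tsum_congr fun o => ?_)
  rw [← mul_add]
  congr 1
  refine (tsum_map_mul (law (f o.1)) _ _).trans ?_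
  simp only [Nat.cast_add, mul_add, ENNReal.tsum_add]
  rw [ENNReal.tsum_mul_right, PMF.tsum_coe, one_mul, expectedTime_eq]

theorem expect_const {α : Type} (c : RandTimed α) (r : ℝ≥0∞) :
    expect c (fun _ => r) = r := by
  unfold expect
  rw [ENNReal.tsum_mul_right, PMF.tsum_coe, one_mul]

theorem expect_mono {α : Type} (c : RandTimed α) {g h : α → ℝ≥0∞} (hgh : ∀ a, g a ≤ h a) :
    expect c g ≤ expect c h :=
  ENNReal.tsum_le_tsum fun o => by gcongr; exact hgh _

theorem expect_le_const {α : Type} (c : RandTimed α) {g : α → ℝ≥0∞} {r : ℝ≥0∞}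
    (h : ∀ a, g a ≤ r) : expect c g ≤ r :=
  (expect_mono c h).trans (expect_const c r).le

theorem failureProbability_eq_expect {α : Type} (c : RandTimed α) (S : α → Prop)
    [DecidablePred S] :
    failureProbability c S = expect c fun a => if S a then 0 else 1 := by
  refine (PMF.toOuterMeasure_apply (law c) _).trans ?_
  refine tsum_congr fun o => ?_
  by_cases h : S o.1 <;> simp [Set.indicator, h]

/-- The probability of the outcome `a`. -/
noncomputable def prob {α : Type} (c : RandTimed α) (a : α) : ℝ≥0∞ :=
  ∑' k : ℕ, law c (a, k)

theorem expect_eq_tsum_prob {α : Type} (c : RandTimed α) (g : α → ℝ≥0∞) :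
    expect c g = ∑' a, prob c a * g a := by
  unfold expect prob
  rw [ENNReal.tsum_prod']
  exact tsum_congr fun a => by rw [← ENNReal.tsum_mul_right]

theorem tsum_prob {α : Type} (c : RandTimed α) : ∑' a, prob c a = 1 := by
  have h := expect_const c 1
  rw [expect_eq_tsum_prob] at h
  simpa using h

theorem prob_eq_expect {α : Type} [DecidableEq α] (c : RandTimed α) (a : α) :
    prob c a = expect c fun b => if b = a then 1 else 0 := by
  rw [expect_eq_tsum_prob, tsum_eq_single a]
  · simp
  · intro b hb
    simp [hb]

theorem prob_bind {α β : Type} (c : RandTimed α) (f : α → RandTimed β) (b : β) :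
    prob (c >>= f) b = ∑' a, prob c a * prob (f a) b := by
  classical
  rw [prob_eq_expect, expect_bind, expect_eq_tsum_prob]
  simp_rw [prob_eq_expect _ b]

theorem prob_pure {α : Type} [DecidableEq α] (a b : α) :
    prob (pure a : RandTimed α) b = if a = b then 1 else 0 := by
  rw [prob_eq_expect, expect_pure]

theorem tsum_option {α : Type} (g : Option α → ℝ≥0∞) :
    ∑' o, g o = g none + ∑' a, g (some a) := by
  classical
  rw [ENNReal.tsum_eq_add_tsum_ite none]
  congr 1
  have := (Function.Injective.tsum_eq (g := Option.some) (Option.some_injective α)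
    (f := fun o : Option α => @ite _ (o = none) (Classical.propDecidable _) 0 (g o)) (by
      intro o ho
      cases o with
      | none => simp at ho
      | some a => exact ⟨a, rfl⟩))
  refine Eq.trans ?_ (this.symm.trans (by simp))
  exact tsum_congr fun o => by congr

/-! ## Searches and their sequential combination -/

/-- The distribution of the outcome is that of an unbiased search: only solutions are found, and
all of them with the same probability. -/
def IsUnbiased {α : Type} (S : α → Prop) (c : RandTimed (Option α)) : Prop :=
  (∀ z, ¬ S z → prob c (some z) = 0) ∧
    ∀ z z', S z → S z' → prob c (some z) = prob c (some z')

theorem firstSuccess_cons {α : Type} (c : RandTimed (Option α)) (cs : List (RandTimed (Option α))) :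
    firstSuccess (c :: cs) =
      c >>= fun o => match o with
        | some a => pure (some a)
        | none => firstSuccess cs := rfl

theorem prob_none_firstSuccess_cons {α : Type} (c : RandTimed (Option α))
    (cs : List (RandTimed (Option α))) :
    prob (firstSuccess (c :: cs)) none = prob c none * prob (firstSuccess cs) none := by
  classical
  rw [firstSuccess_cons, prob_bind, tsum_option]
  simp [prob_pure]

theorem prob_some_firstSuccess_cons {α : Type} (c : RandTimed (Option α))
    (cs : List (RandTimed (Option α))) (z : α) :
    prob (firstSuccess (c :: cs)) (some z) =
      prob c none * prob (firstSuccess cs) (some z) + prob c (some z) := by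
  classical
  rw [firstSuccess_cons, prob_bind, tsum_option]
  simp [prob_pure]

theorem prob_none_firstSuccess {α : Type} (cs : List (RandTimed (Option α))) :
    prob (firstSuccess cs) none = (cs.map fun c => prob c none).prod := by
  classical
  induction cs with
  | nil => simp [firstSuccess, prob_pure]
  | cons c cs ih => rw [prob_none_firstSuccess_cons, ih]; simp

theorem prob_le_one {α : Type} (c : RandTimed α) (a : α) : prob c a ≤ 1 :=
  (ENNReal.le_tsum a).trans (tsum_prob c).le

theorem expectedTime_firstSuccess_nil {α : Type} :
    expectedTime (firstSuccess ([] : List (RandTimed (Option α)))) = 0 :=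
  expectedTime_pure _

theorem expectedTime_firstSuccess_cons {α : Type} (c : RandTimed (Option α))
    (cs : List (RandTimed (Option α))) :
    expectedTime (firstSuccess (c :: cs)) =
      expectedTime c + prob c none * expectedTime (firstSuccess cs) := by
  rw [firstSuccess_cons, expectedTime_bind, expect_eq_tsum_prob, tsum_option]
  simp [expectedTime_pure]

theorem expectedTime_firstSuccess_le {α : Type} (cs : List (RandTimed (Option α))) :
    expectedTime (firstSuccess cs) ≤ (cs.map expectedTime).sum := by
  induction cs with
  | nil => simp [expectedTime_firstSuccess_nil]
  | cons c cs ih =>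
    rw [expectedTime_firstSuccess_cons, List.map_cons, List.sum_cons]
    gcongr
    exact (mul_le_of_le_one_left' (prob_le_one _ _)).trans ih

theorem IsUnbiased.firstSuccess {α : Type} {S : α → Prop} {cs : List (RandTimed (Option α))}
    (h : ∀ c ∈ cs, IsUnbiased S c) : IsUnbiased S (firstSuccess cs) := by
  classical
  induction cs with
  | nil => constructor <;> intros <;> simp [Maxpoints.firstSuccess, prob_pure]
  | cons c cs ih =>
    have hc := h c (by simp)
    have hcs := ih fun c' hc' => h c' (by simp [hc'])
    constructor
    · intro z hz
      rw [prob_some_firstSuccess_cons, hc.1 z hz, hcs.1 z hz]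
      simp
    · intro z z' hz hz'
      rw [prob_some_firstSuccess_cons, prob_some_firstSuccess_cons, hc.2 z z' hz hz',
        hcs.2 z z' hz hz']

theorem IsUnbiased.bind {α β : Type} {S : α → Prop} {c : RandTimed β}
    {f : β → RandTimed (Option α)} (h : ∀ b, IsUnbiased S (f b)) : IsUnbiased S (c >>= f) := by
  constructor
  · intro z hz
    simp [prob_bind, (h _).1 z hz]
  · intro z z' hz hz'
    simp_rw [prob_bind, (h _).2 z z' hz hz']

/-- The solutions have equal probabilities with sum at most one. -/
theorem IsUnbiased.prob_some_le {α : Type} [Fintype α] {S : α → Prop} [DecidablePred S]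
    {c : RandTimed (Option α)} (h : IsUnbiased S c) (z : α) :
    prob c (some z) ≤ if S z then ((Finset.univ.filter S).card : ℝ≥0∞)⁻¹ else 0 := by
  split_ifs with hz
  · have hsum : ∑ y ∈ Finset.univ.filter S, prob c (some y) ≤ 1 := by
      rw [← tsum_prob c, tsum_option, tsum_fintype]
      refine le_trans ?_ le_add_self
      exact Finset.sum_le_sum_of_subset (Finset.filter_subset _ _)
    rw [Finset.sum_congr rfl fun y hy => h.2 y z (Finset.mem_filter.mp hy).2 hz,
      Finset.sum_const, nsmul_eq_mul, mul_comm] at hsum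
    exact ENNReal.le_inv_iff_mul_le.mpr hsum
  · exact (h.1 z hz).le

/-! ## The amplitudes after some Grover iterations -/

theorem phaseOracle_apply {ι : Type} [Fintype ι] (χ : ι → Bool) (v : EuclideanSpace ℂ ι) (x : ι) :
    phaseOracle χ v x = if χ x then -v x else v x := by
  unfold phaseOracle
  rw [LinearIsometryEquiv.piLpCongrRight_apply]
  by_cases h : χ x <;> simp [h]

theorem diffusion_apply {ι : Type} [Fintype ι] (ψ : QState ι) (v : EuclideanSpace ℂ ι) (x : ι) :
    diffusion ψ v x = 2 * inner ℂ ψ.1 v * ψ.1 x - v x := by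
  have h : ‖ψ.1‖ = 1 := mem_sphere_zero_iff_norm.mp ψ.2
  unfold diffusion
  rw [Submodule.reflection_singleton_apply]
  simp [h, mul_assoc]

theorem sum_norm_sq_eq_one {ι : Type} [Fintype ι] (ψ : QState ι) : ∑ x, ‖ψ.1 x‖ ^ 2 = 1 := by
  rw [← EuclideanSpace.norm_sq_eq, mem_sphere_zero_iff_norm.mp ψ.2, one_pow]

theorem sum_unmarked_norm_sq {ι : Type} [Fintype ι] (ψ : QState ι) (χ : ι → Bool) (θ : ℝ)
    (hθ : ∑ x, (if χ x then ‖ψ.1 x‖ ^ 2 else 0) = Real.sin θ ^ 2) :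
    ∑ x, (if χ x then 0 else ‖ψ.1 x‖ ^ 2) = Real.cos θ ^ 2 := by
  rw [Real.cos_sq', ← hθ, eq_sub_iff_add_eq, ← Finset.sum_add_distrib]
  refine Eq.trans (Finset.sum_congr rfl fun x _ => ?_) (sum_norm_sq_eq_one ψ)
  split_ifs <;> simp

/-- An iteration rotates by `2θ` in the plane spanned by the marked and the unmarked part of `ψ`.
The initial state is arbitrary, so that the formula also serves the exact search with its auxiliary
qubit. -/
theorem groverState_apply {ι : Type} [Fintype ι] (ψ : QState ι) (χ : ι → Bool) (θ : ℝ)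
    (hθ : ∑ x, (if χ x then ‖ψ.1 x‖ ^ 2 else 0) = Real.sin θ ^ 2) (j : ℕ) (x : ι) :
    (groverState ψ χ j).1 x =
      ((if χ x then Real.sin ((2 * j + 1) * θ) / Real.sin θ
        else Real.cos ((2 * j + 1) * θ) / Real.cos θ : ℝ) : ℂ) * ψ.1 x := by
  have hcos := sum_unmarked_norm_sq ψ χ θ hθ
  -- A vanishing `sin θ` or `cos θ` makes the quotient in the formula meaningless, but then the
  -- amplitude that it multiplies is zero.
  have hzero : ∀ x, (if χ x then Real.sin θ = 0 else Real.cos θ = 0) → ψ.1 x = 0 := by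
    intro x hx
    by_cases h : χ x
    · rw [if_pos h] at hx
      rw [hx, zero_pow two_ne_zero] at hθ
      have := (Finset.sum_eq_zero_iff_of_nonneg (fun y _ => by split_ifs <;> positivity)).mp hθ x
        (Finset.mem_univ x)
      simpa [h] using this
    · rw [if_neg h] at hx
      rw [hx, zero_pow two_ne_zero] at hcos
      have := (Finset.sum_eq_zero_iff_of_nonneg (fun y _ => by split_ifs <;> positivity)).mp hcos x
        (Finset.mem_univ x)
      simpa [h] using this
  induction j generalizing x with
  | zero =>
    by_cases h0 : (if χ x then Real.sin θ = 0 else Real.cos θ = 0)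
    · simp [groverState, hzero x h0]
    · by_cases h : χ x
      · rw [if_pos h] at h0
        simp [groverState, h, h0]
      · rw [if_neg h] at h0
        simp [groverState, h, h0]
  | succ j ih =>
    have hstep : (groverState ψ χ (j + 1)).1 =
        diffusion ψ (phaseOracle χ (groverState ψ χ j).1) := by
      unfold groverState
      rw [Function.iterate_succ_apply']
      rfl
    -- The overlap is `cos θ cos ((2j+1)θ) - sin θ sin ((2j+1)θ)`.
    have hinner : inner ℂ ψ.1 (phaseOracle χ (groverState ψ χ j).1) =
        ((Real.cos ((2 * j + 2) * θ) : ℝ) : ℂ) := by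
      have : ∀ y, inner ℂ (ψ.1 y) (phaseOracle χ (groverState ψ χ j).1 y) =
          (((if χ y then ‖ψ.1 y‖ ^ 2 else 0) * (-(Real.sin ((2 * j + 1) * θ) / Real.sin θ)) +
            (if χ y then 0 else ‖ψ.1 y‖ ^ 2) * (Real.cos ((2 * j + 1) * θ) / Real.cos θ) : ℝ) :
              ℂ) := by
        intro y
        rw [phaseOracle_apply, ih y]
        have hn : inner ℂ (ψ.1 y) (ψ.1 y) = ((‖ψ.1 y‖ ^ 2 : ℝ) : ℂ) := by
          rw [inner_self_eq_norm_sq_to_K]; norm_cast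
        have hn' := hn
        rw [RCLike.inner_apply] at hn'
        by_cases h : χ y
        · simp only [h, if_true, RCLike.inner_apply, zero_mul, add_zero, Complex.ofReal_mul,
            Complex.ofReal_neg, ← hn']
          ring
        · simp only [h, if_false, RCLike.inner_apply, zero_mul, zero_add, Complex.ofReal_mul,
            ← hn', Bool.false_eq_true]
          ring
      rw [PiLp.inner_apply]
      simp only [this]
      rw [← Complex.ofReal_sum, Finset.sum_add_distrib, ← Finset.sum_mul, ← Finset.sum_mul, hθ,
        hcos]
      congr 1
      have h1 : Real.sin θ ^ 2 * -(Real.sin ((2 * j + 1) * θ) / Real.sin θ) =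
          - (Real.sin θ * Real.sin ((2 * j + 1) * θ)) := by
        by_cases h : Real.sin θ = 0
        · simp [h]
        · field_simp
      have h2 : Real.cos θ ^ 2 * (Real.cos ((2 * j + 1) * θ) / Real.cos θ) =
          Real.cos θ * Real.cos ((2 * j + 1) * θ) := by
        by_cases h : Real.cos θ = 0
        · simp [h]
        · field_simp
      rw [h1, h2, show (2 * (j : ℝ) + 2) * θ = (2 * j + 1) * θ + θ by ring, Real.cos_add]
      ring
    rw [hstep, diffusion_apply, hinner, phaseOracle_apply, ih x]
    by_cases h0 : (if χ x then Real.sin θ = 0 else Real.cos θ = 0)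
    · simp [hzero x h0]
    · by_cases h : χ x
      · rw [if_pos h] at h0
        simp only [h, if_true]
        -- With `a = (2j+2)θ`, this is `sin (a+θ) - sin (a-θ) = 2 cos a sin θ`; the unmarked case
        -- uses the corresponding identity for cosines.
        have : Real.sin ((2 * ((j + 1 : ℕ) : ℝ) + 1) * θ) / Real.sin θ =
            2 * Real.cos ((2 * j + 2) * θ) + Real.sin ((2 * j + 1) * θ) / Real.sin θ := by
          rw [show (2 * ((j + 1 : ℕ) : ℝ) + 1) * θ = (2 * j + 2) * θ + θ by push_cast; ring,
            show (2 * (j : ℝ) + 1) * θ = (2 * j + 2) * θ - θ by ring, Real.sin_add, Real.sin_sub]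
          field_simp
          ring
        rw [this]
        push_cast
        ring
      · rw [if_neg h] at h0
        simp only [h, if_false, Bool.false_eq_true]
        have : Real.cos ((2 * ((j + 1 : ℕ) : ℝ) + 1) * θ) / Real.cos θ =
            2 * Real.cos ((2 * j + 2) * θ) - Real.cos ((2 * j + 1) * θ) / Real.cos θ := by
          rw [show (2 * ((j + 1 : ℕ) : ℝ) + 1) * θ = (2 * j + 2) * θ + θ by push_cast; ring,
            show (2 * (j : ℝ) + 1) * θ = (2 * j + 2) * θ - θ by ring, Real.cos_add, Real.cos_sub]
          field_simp
          ring
        rw [this]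
        push_cast
        ring

/-! ## Measuring -/

theorem expect_map_pmf {α β : Type} (c : PMF β) (f : β → α) (k : β → ℕ) (g : α → ℝ≥0∞) :
    expect (show RandTimed α from c.map fun x => (f x, k x)) g = ∑' x, c x * g (f x) :=
  tsum_map_mul c (fun x => (f x, k x)) fun o => g o.1

theorem expectedTime_map_pmf {α β : Type} (c : PMF β) (f : β → α) (k : ℕ) :
    expectedTime (show RandTimed α from c.map fun x => (f x, k)) = k := by
  refine (tsum_map_mul c (fun x => (f x, k)) fun o : α × ℕ => (o.2 : ℝ≥0∞)).trans ?_
  have h : ∑' x, c x * (k : ℝ≥0∞) = k := by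
    rw [ENNReal.tsum_mul_right, PMF.tsum_coe, one_mul]
  exact h

theorem expect_groverMeasure {ι : Type} [Fintype ι] (ψ : QState ι) (f : ι → Timed Bool) (j : ℕ)
    (g : ι → ℝ≥0∞) :
    expect (groverMeasure ψ f j) g =
      ∑ x, ENNReal.ofReal (‖(groverState ψ (fun x => (f x).val) j).1 x‖ ^ 2) * g x := by
  refine (expect_map_pmf _ _ _ _).trans ?_
  rw [tsum_fintype]
  rfl

theorem expectedTime_groverMeasure {ι : Type} [Fintype ι] (ψ : QState ι) (f : ι → Timed Bool)
    (j : ℕ) :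
    expectedTime (groverMeasure ψ f j) =
      ((2 * registerCost ι + j * (2 * worstTime f + 1 + 3 * registerCost ι) : ℕ) : ℝ≥0∞) :=
  expectedTime_map_pmf _ _ _

theorem time_le_worstTime {ι α : Type} [Fintype ι] (f : ι → Timed α) (x : ι) :
    (f x).time ≤ worstTime f :=
  Finset.le_sup (f := fun x => (f x).time) (Finset.mem_univ x)

theorem exists_angle {ι : Type} [Fintype ι] (ψ : QState ι) (χ : ι → Bool) :
    ∃ θ : ℝ, ∑ x, (if χ x then ‖ψ.1 x‖ ^ 2 else 0) = Real.sin θ ^ 2 := by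
  have h0 : 0 ≤ ∑ x, (if χ x then ‖ψ.1 x‖ ^ 2 else 0) :=
    Finset.sum_nonneg fun x _ => by split_ifs <;> positivity
  have h1 : ∑ x, (if χ x then ‖ψ.1 x‖ ^ 2 else 0) ≤ 1 := by
    refine le_trans (Finset.sum_le_sum fun x _ => ?_) (sum_norm_sq_eq_one ψ).le
    split_ifs
    · exact le_rfl
    · positivity
  refine ⟨Real.arcsin (Real.sqrt (∑ x, (if χ x then ‖ψ.1 x‖ ^ 2 else 0))), ?_⟩
  rw [Real.sin_arcsin (by linarith [Real.sqrt_nonneg (∑ x, (if χ x then ‖ψ.1 x‖ ^ 2 else 0))])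
    (Real.sqrt_le_one.mpr h1), Real.sq_sqrt h0]

/-- The symmetry behind unbiasedness: the rotation cannot tell apart two states with the same mark
and the same initial amplitude. -/
theorem groverState_congr {ι : Type} [Fintype ι] (ψ : QState ι) (χ : ι → Bool) (j : ℕ) {x y : ι}
    (hχ : χ x = χ y) (hψ : ψ.1 x = ψ.1 y) : (groverState ψ χ j).1 x = (groverState ψ χ j).1 y := by
  obtain ⟨θ, hθ⟩ := exists_angle ψ χ
  rw [groverState_apply ψ χ θ hθ, groverState_apply ψ χ θ hθ, hχ, hψ]

/-- The unmarked weight `cos² θ` is rescaled by the factor of `groverState_apply`. An inequality is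
enough, and it disposes of `cos θ = 0` at once. -/
theorem sum_unmarked_groverState_le {ι : Type} [Fintype ι] (ψ : QState ι) (χ : ι → Bool) (θ : ℝ)
    (hθ : ∑ x, (if χ x then ‖ψ.1 x‖ ^ 2 else 0) = Real.sin θ ^ 2) (j : ℕ) :
    ∑ x, ENNReal.ofReal (‖(groverState ψ χ j).1 x‖ ^ 2) * (if χ x then 0 else 1) ≤
      ENNReal.ofReal (Real.cos ((2 * j + 1) * θ) ^ 2) := by
  have hcos := sum_unmarked_norm_sq ψ χ θ hθ
  have h : ∀ x, ENNReal.ofReal (‖(groverState ψ χ j).1 x‖ ^ 2) * (if χ x then 0 else 1) =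
      ENNReal.ofReal ((if χ x then 0 else ‖ψ.1 x‖ ^ 2) *
        (Real.cos ((2 * j + 1) * θ) / Real.cos θ) ^ 2) := by
    intro x
    rw [groverState_apply ψ χ θ hθ]
    by_cases hx : χ x
    · simp [hx]
    · simp only [hx, if_false, mul_one, norm_mul, Complex.norm_real, Real.norm_eq_abs, mul_pow,
        sq_abs, Bool.false_eq_true]
      rw [mul_comm]
  simp only [h]
  rw [← ENNReal.ofReal_sum_of_nonneg fun x _ => by split_ifs <;> positivity, ← Finset.sum_mul, hcos]
  refine ENNReal.ofReal_le_ofReal ?_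
  by_cases h0 : Real.cos θ = 0
  · rw [h0]; simp; positivity
  · rw [div_pow, mul_div_cancel₀ _ (pow_ne_zero 2 h0)]

/-! ## Grover's algorithm -/

section Search

variable {D : Type} [Fintype D]

/-- The number of solutions. -/
def solCount (f : D → Timed Bool) : ℕ :=
  (Finset.univ.filter fun x => (f x).val = true).card

/-- A bound for the time of one Grover iteration, with the costs that come with a search. -/
def searchUnit (f : D → Timed Bool) : ℕ :=
  2 * worstTime f + 3 * registerCost D + 7

theorem solCount_le_card (f : D → Timed Bool) : solCount f ≤ Fintype.card D :=
  Finset.card_filter_le _ _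

variable [Nonempty D]

/-- The angle of the uniform superposition with respect to the solutions. -/
noncomputable def searchAngle (f : D → Timed Bool) : ℝ :=
  Real.arcsin (Real.sqrt (solCount f / Fintype.card D))

theorem sin_searchAngle (f : D → Timed Bool) :
    Real.sin (searchAngle f) = Real.sqrt (solCount f / Fintype.card D) := by
  refine Real.sin_arcsin (by linarith [Real.sqrt_nonneg ((solCount f : ℝ) / Fintype.card D)])
    (Real.sqrt_le_one.mpr ?_)
  exact div_le_one_of_le₀ (by exact_mod_cast solCount_le_card f) (by positivity)

theorem uniformState_norm_sq (x : D) : ‖(uniformState D).1 x‖ ^ 2 = ((Fintype.card D : ℝ))⁻¹ := by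
  have h : (uniformState D).1 x = (((Real.sqrt (Fintype.card D))⁻¹ : ℝ) : ℂ) := rfl
  rw [h, Complex.norm_real, Real.norm_eq_abs, sq_abs, inv_pow, Real.sq_sqrt (by positivity)]

theorem uniformState_angle (f : D → Timed Bool) :
    ∑ x, (if (f x).val then ‖(uniformState D).1 x‖ ^ 2 else 0) =
      Real.sin (searchAngle f) ^ 2 := by
  rw [sin_searchAngle, Real.sq_sqrt (by positivity)]
  simp only [uniformState_norm_sq]
  rw [← Finset.sum_filter, Finset.sum_const, nsmul_eq_mul, solCount, div_eq_mul_inv]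

theorem grover_eq (f : D → Timed Bool) (j : ℕ) :
    grover f j = groverMeasure (uniformState D) f j >>= fun x => run (f x) >>= fun b =>
      pure (if b then some x else none) := rfl

theorem expect_grover (f : D → Timed Bool) (j : ℕ) (g : Option D → ℝ≥0∞) :
    expect (grover f j) g =
      ∑ x, ENNReal.ofReal (‖(groverState (uniformState D) (fun x => (f x).val) j).1 x‖ ^ 2) *
        g (if (f x).val then some x else none) := by
  rw [grover_eq, expect_bind, expect_groverMeasure]
  simp only [expect_bind, expect_run, expect_pure]

theorem prob_grover_none_le (f : D → Timed Bool) (j : ℕ) :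
    prob (grover f j) none ≤ ENNReal.ofReal (Real.cos ((2 * j + 1) * searchAngle f) ^ 2) := by
  classical
  rw [prob_eq_expect, expect_grover]
  refine le_trans (le_of_eq ?_) (sum_unmarked_groverState_le (uniformState D)
    (fun x => (f x).val) (searchAngle f) (uniformState_angle f) j)
  refine Finset.sum_congr rfl fun x _ => ?_
  by_cases h : (f x).val <;> simp [h]

theorem isUnbiased_grover (f : D → Timed Bool) (j : ℕ) :
    IsUnbiased (fun x => (f x).val = true) (grover f j) := by
  classical
  have key : ∀ z, prob (grover f j) (some z) = if (f z).val then
      ENNReal.ofReal (‖(groverState (uniformState D) (fun x => (f x).val) j).1 z‖ ^ 2) else 0 := by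
    intro z
    rw [prob_eq_expect, expect_grover, Finset.sum_eq_single z]
    · by_cases h : (f z).val <;> simp [h]
    · intro x _ hx
      by_cases h : (f x).val <;> simp [h, hx]
    · simp
  constructor
  · intro z hz
    rw [key, if_neg hz]
  · intro z z' hz hz'
    rw [key, key, if_pos hz, if_pos hz']
    rw [groverState_congr (uniformState D) (fun x => (f x).val) j (x := z) (y := z')
      (by rw [hz, hz']) rfl]

/-- Preparation, measurement and the final test are charged as one more iteration. -/
theorem expectedTime_grover_le (f : D → Timed Bool) (j : ℕ) :
    expectedTime (grover f j) ≤
      ((j + 1) * (2 * worstTime f + 1 + 3 * registerCost D) : ℕ) := by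
  rw [grover_eq, expectedTime_bind, expectedTime_groverMeasure]
  simp only [expectedTime_bind, expectedTime_run, expectedTime_pure, expect_const, add_zero]
  refine (add_le_add_right (expect_le_const (r := (worstTime f : ℝ≥0∞)) _ fun x => ?_) _).trans ?_
  · exact_mod_cast time_le_worstTime f x
  · norm_cast
    rw [add_mul, one_mul]
    omega

/-! ## A random number of iterations -/

theorem expect_randomBelow {M : ℕ} (hM : 0 < M) (g : ℕ → ℝ≥0∞) :
    expect (randomBelow M) g = (M : ℝ≥0∞)⁻¹ * ∑ j ∈ Finset.range M, g j := by
  obtain ⟨k, rfl⟩ := Nat.exists_eq_succ_of_ne_zero hM.ne'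
  have h : randomBelow (k + 1) = randomElement (Fin (k + 1)) >>= fun j => pure (j : ℕ) := rfl
  rw [Nat.succ_eq_add_one, h, expect_bind]
  simp only [expect_pure]
  refine (expect_map_pmf _ _ _ _).trans ?_
  rw [tsum_fintype, Finset.sum_range, Finset.mul_sum]
  simp [PMF.uniformOfFintype_apply]

/-- From `M ≤ 2 ^ (M - 1)`; thus drawing the random number of iterations costs no more than one step
per possible value. -/
theorem registerCost_fin_le {M : ℕ} (hM : 0 < M) : registerCost (Fin M) ≤ M := by
  unfold registerCost
  rw [Fintype.card_fin]
  have : Nat.clog 2 M ≤ M - 1 := by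
    refine Nat.clog_le_of_le_pow ?_
    have := Nat.lt_two_pow_self (n := M - 1)
    omega
  omega

theorem expectedTime_randomBelow_le {M : ℕ} (hM : 0 < M) :
    expectedTime (randomBelow M) ≤ M := by
  obtain ⟨k, rfl⟩ := Nat.exists_eq_succ_of_ne_zero hM.ne'
  have h : randomBelow (k + 1) = randomElement (Fin (k + 1)) >>= fun j => pure (j : ℕ) := rfl
  rw [Nat.succ_eq_add_one, h, expectedTime_bind]
  simp only [expectedTime_pure, expect_const, add_zero]
  refine (expectedTime_map_pmf _ _ _).le.trans ?_
  exact_mod_cast registerCost_fin_le hM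

theorem groverRandom_eq (f : D → Timed Bool) (m : ℝ) :
    groverRandom f m = randomBelow ⌈m⌉₊ >>= fun j => grover f j := rfl

theorem isUnbiased_groverRandom (f : D → Timed Bool) (m : ℝ) :
    IsUnbiased (fun x => (f x).val = true) (groverRandom f m) :=
  IsUnbiased.bind fun j => isUnbiased_grover f j

theorem expect_randomBelow_le {M : ℕ} (hM : 0 < M) (g : ℕ → ℝ≥0∞) (r : ℝ≥0∞)
    (h : ∀ j < M, g j ≤ r) : expect (randomBelow M) g ≤ r := by
  rw [expect_randomBelow hM]
  calc (M : ℝ≥0∞)⁻¹ * ∑ j ∈ Finset.range M, g j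
      ≤ (M : ℝ≥0∞)⁻¹ * ∑ j ∈ Finset.range M, r := by
        gcongr with j hj
        exact h j (Finset.mem_range.mp hj)
    _ = r := by
        rw [Finset.sum_const, Finset.card_range, nsmul_eq_mul, ← mul_assoc,
          ENNReal.inv_mul_cancel (by exact_mod_cast hM.ne') (ENNReal.natCast_ne_top M), one_mul]

theorem expectedTime_groverRandom_le (f : D → Timed Bool) {m : ℝ} (hm : 1 ≤ m) :
    expectedTime (groverRandom f m) ≤ ENNReal.ofReal (2 * m * searchUnit f) := by
  have hM : 0 < ⌈m⌉₊ := Nat.ceil_pos.mpr (by linarith)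
  have h : expectedTime (groverRandom f m) ≤ ((⌈m⌉₊ * searchUnit f : ℕ) : ℝ≥0∞) := by
    rw [groverRandom_eq, expectedTime_bind]
    refine (add_le_add (expectedTime_randomBelow_le hM)
      (expect_randomBelow_le hM _
        ((⌈m⌉₊ * (2 * worstTime f + 1 + 3 * registerCost D) : ℕ) : ℝ≥0∞) fun j hj => ?_)).trans ?_
    · refine (expectedTime_grover_le f j).trans ?_
      exact_mod_cast Nat.mul_le_mul_right _ hj
    · norm_cast
      unfold searchUnit
      calc ⌈m⌉₊ + ⌈m⌉₊ * (2 * worstTime f + 1 + 3 * registerCost D)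
          = ⌈m⌉₊ * (2 * worstTime f + 3 * registerCost D + 2) := by ring
        _ ≤ _ := Nat.mul_le_mul_left _ (by omega)
  refine h.trans ?_
  rw [← ENNReal.ofReal_natCast]
  refine ENNReal.ofReal_le_ofReal ?_
  push_cast
  gcongr
  linarith [Nat.ceil_lt_add_one (show 0 ≤ m by linarith)]

/-- Telescoping: `2 cos ((4j+2)θ) sin 2θ = sin (4(j+1)θ) - sin (4jθ)`. -/
theorem sum_cos_mul_sin (θ : ℝ) (M : ℕ) :
    (∑ j ∈ Finset.range M, Real.cos ((4 * j + 2) * θ)) * (2 * Real.sin (2 * θ)) =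
      Real.sin (4 * M * θ) := by
  induction M with
  | zero => simp
  | succ M ih =>
    rw [Finset.sum_range_succ, add_mul, ih,
      show 4 * (M : ℝ) * θ = (4 * M + 2) * θ - 2 * θ by ring,
      show 4 * ((M + 1 : ℕ) : ℝ) * θ = (4 * M + 2) * θ + 2 * θ by push_cast; ring,
      Real.sin_add, Real.sin_sub]
    ring

/-- By `sum_cos_mul_sin` it suffices that `sin 4Mθ ≤ M sin 2θ`. For `θ ≤ π/4` the right side is `2
(M sin θ) cos θ ≥ 1`. For larger `θ` one passes to the complement `δ = π/2 - θ`, where Jordan's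
inequality applies. At `θ = π/2` one cannot divide by `sin 2θ`, but every term is `-1`. -/
theorem sum_cos_le {θ : ℝ} (h0 : 0 ≤ θ) (h1 : θ ≤ Real.pi / 2) {M : ℕ}
    (hM : 1 ≤ M * Real.sin θ) :
    ∑ j ∈ Finset.range M, Real.cos ((4 * j + 2) * θ) ≤ M / 2 := by
  have hpi := Real.pi_pos
  rcases h1.eq_or_lt with h1 | h1
  · have : ∀ j ∈ Finset.range M, Real.cos ((4 * j + 2) * θ) ≤ 0 := by
      intro j _
      rw [h1, show (4 * (j : ℝ) + 2) * (Real.pi / 2) = Real.pi + j * (2 * Real.pi) by ring,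
        Real.cos_add_nat_mul_two_pi, Real.cos_pi]
      norm_num
    exact (Finset.sum_nonpos this).trans (by positivity)
  have hθ : 0 < θ := by
    rcases h0.eq_or_lt with h | h
    · rw [← h, Real.sin_zero] at hM; linarith
    · exact h
  have hs : 0 < Real.sin (2 * θ) := Real.sin_pos_of_pos_of_lt_pi (by linarith) (by linarith)
  have hsum := sum_cos_mul_sin θ M
  suffices h : Real.sin (4 * M * θ) ≤ M * Real.sin (2 * θ) by
    rw [← hsum] at h
    have : (∑ j ∈ Finset.range M, Real.cos ((4 * j + 2) * θ)) * (2 * Real.sin (2 * θ)) ≤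
        M / 2 * (2 * Real.sin (2 * θ)) := by linarith
    exact le_of_mul_le_mul_right this (by linarith)
  have hMs : 0 < Real.sin θ := Real.sin_pos_of_pos_of_lt_pi hθ (by linarith)
  rcases le_total θ (Real.pi / 4) with h4 | h4
  · refine (Real.sin_le_one _).trans ?_
    rw [Real.sin_two_mul]
    have hc : 1 / 2 ≤ Real.cos θ := by
      have := Real.cos_le_cos_of_nonneg_of_le_pi h0 (by linarith) (show θ ≤ Real.pi / 3 by linarith)
      rwa [Real.cos_pi_div_three] at this
    nlinarith
  · set δ := Real.pi / 2 - θ with hδ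
    have e1 : Real.sin (2 * θ) = Real.sin (2 * δ) := by
      rw [← Real.sin_pi_sub]; congr 1; rw [hδ]; ring
    have e2 : Real.sin (4 * M * θ) = - Real.sin (4 * M * δ) := by
      rw [show 4 * (M : ℝ) * θ = M * (2 * Real.pi) - 4 * M * δ by rw [hδ]; ring,
        Real.sin_nat_mul_two_pi_sub]
    rw [e2, e1]
    rw [e1] at hs
    have hδ0 : 0 < δ := by linarith
    have hJ : 4 / Real.pi * δ ≤ Real.sin (2 * δ) := by
      have := Real.mul_le_sin (x := 2 * δ) (by linarith) (by linarith)
      calc 4 / Real.pi * δ = 2 / Real.pi * (2 * δ) := by ring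
        _ ≤ _ := this
    -- Either `4Mδ ≤ π`, and the left side `-sin 4Mδ` is not positive, or Jordan's inequality makes
    -- the right side at least `1`.
    rcases le_total (4 * M * δ) Real.pi with h | h
    · have := Real.sin_nonneg_of_nonneg_of_le_pi (x := 4 * M * δ) (by positivity) h
      have : 0 ≤ M * Real.sin (2 * δ) := by positivity
      linarith
    · have : 1 ≤ M * Real.sin (2 * δ) :=
        calc 1 ≤ (4 * M * δ) / Real.pi := by rwa [le_div_iff₀ hpi, one_mul]
          _ = M * (4 / Real.pi * δ) := by ring
          _ ≤ _ := by gcongr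
      linarith [Real.neg_one_le_sin (4 * M * δ)]

/-- Since `cos² x = 1/2 + (cos 2x)/2`, the mean is at most `1/2 + 1/4`. -/
theorem sum_cos_sq_le {θ : ℝ} (h0 : 0 ≤ θ) (h1 : θ ≤ Real.pi / 2) {M : ℕ}
    (hM : 1 ≤ M * Real.sin θ) :
    ∑ j ∈ Finset.range M, Real.cos ((2 * j + 1) * θ) ^ 2 ≤ 3 / 4 * M := by
  have h : ∀ j : ℕ, Real.cos ((2 * j + 1) * θ) ^ 2 = 1 / 2 + Real.cos ((4 * j + 2) * θ) / 2 := by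
    intro j
    rw [Real.cos_sq, show 2 * ((2 * (j : ℝ) + 1) * θ) = (4 * j + 2) * θ by ring]
  simp only [h]
  have hc := sum_cos_le h0 h1 hM
  rw [Finset.sum_add_distrib, Finset.sum_const, Finset.card_range, nsmul_eq_mul, ← Finset.sum_div]
  linarith

/-- With `sin θ = √(t/N)`, the choice of `m` gives `⌈m⌉ sin θ ≥ 1`, so the mean of `cos² ((2j+1)θ)`
over the random `j` is at most `3/4`. Large `t` needs no separate treatment. -/
theorem prob_groverRandom_none_le (f : D → Timed Bool) {m : ℝ} (ht : 0 < solCount f)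
    (hm : Real.sqrt (Fintype.card D / solCount f) ≤ m) :
    prob (groverRandom f m) none ≤ ENNReal.ofReal (3 / 4) := by
  classical
  have hN : (0 : ℝ) < Fintype.card D := by exact_mod_cast Fintype.card_pos
  have ht' : (0 : ℝ) < solCount f := by exact_mod_cast ht
  have hm0 : 0 < m := lt_of_lt_of_le (by positivity) hm
  have hM : 0 < ⌈m⌉₊ := Nat.ceil_pos.mpr hm0
  have hMr : (0 : ℝ) < ⌈m⌉₊ := by exact_mod_cast hM
  have hsin : 1 ≤ (⌈m⌉₊ : ℝ) * Real.sin (searchAngle f) := by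
    rw [sin_searchAngle]
    calc (1 : ℝ) = Real.sqrt (Fintype.card D / solCount f) *
          Real.sqrt (solCount f / Fintype.card D) := by
          rw [← Real.sqrt_mul (by positivity), div_mul_div_comm, mul_comm, div_self (by positivity),
            Real.sqrt_one]
      _ ≤ _ := by
          gcongr
          exact hm.trans (Nat.le_ceil m)
  rw [prob_eq_expect, groverRandom_eq, expect_bind, expect_randomBelow hM]
  calc _ ≤ (⌈m⌉₊ : ℝ≥0∞)⁻¹ * ∑ j ∈ Finset.range ⌈m⌉₊,
        ENNReal.ofReal (Real.cos ((2 * j + 1) * searchAngle f) ^ 2) := by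
        gcongr with j
        rw [← prob_eq_expect]
        exact prob_grover_none_le f j
    _ = ENNReal.ofReal ((⌈m⌉₊ : ℝ)⁻¹ *
          ∑ j ∈ Finset.range ⌈m⌉₊, Real.cos ((2 * j + 1) * searchAngle f) ^ 2) := by
        rw [ENNReal.ofReal_mul (by positivity), ENNReal.ofReal_inv_of_pos hMr,
          ENNReal.ofReal_natCast, ENNReal.ofReal_sum_of_nonneg fun _ _ => by positivity]
    _ ≤ _ := by
        refine ENNReal.ofReal_le_ofReal ?_
        rw [inv_mul_le_iff₀ hMr, mul_comm]
        exact sum_cos_sq_le (Real.arcsin_nonneg.mpr (Real.sqrt_nonneg _))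
          (Real.arcsin_le_pi_div_two _) hsin

end Search

section Search

variable {D : Type}

/-! ## The exact search -/

/-- The predicate of the exact search, on the domain with the auxiliary qubit. -/
def ancillaPredicate (f : D → Timed Bool) (x : D × Bool) : Timed Bool := do
  let b ← f x.1
  tick 1
  return b && x.2

theorem ancillaPredicate_val (f : D → Timed Bool) (x : D × Bool) :
    (ancillaPredicate f x).val = ((f x.1).val && x.2) := rfl

variable [Fintype D]

theorem worstTime_ancillaPredicate_le (f : D → Timed Bool) :
    worstTime (ancillaPredicate f) ≤ worstTime f + 1 :=
  Finset.sup_le fun x _ => Nat.add_le_add_right (time_le_worstTime f x.1) 1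

variable [Nonempty D]

theorem groverExact_eq (f : D → Timed Bool) (t : ℕ) :
    groverExact f t =
      groverMeasure (ancillaState D (exactAngle (Fintype.card D) t)) (ancillaPredicate f)
        (exactIterations (Fintype.card D) t) >>= fun x => run (f x.1) >>= fun b =>
          pure (if b then some x.1 else none) := rfl

theorem expect_groverExact (f : D → Timed Bool) (t : ℕ) (g : Option D → ℝ≥0∞) :
    expect (groverExact f t) g =
      ∑ x, ENNReal.ofReal (‖(groverState (ancillaState D (exactAngle (Fintype.card D) t))
        (fun x => (ancillaPredicate f x).val) (exactIterations (Fintype.card D) t)).1 x‖ ^ 2) *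
        g (if (f x.1).val then some x.1 else none) := by
  rw [groverExact_eq, expect_bind, expect_groverMeasure]
  simp only [expect_bind, expect_run, expect_pure]

theorem isUnbiased_groverExact (f : D → Timed Bool) (t : ℕ) :
    IsUnbiased (fun x => (f x).val = true) (groverExact f t) := by
  classical
  have key : ∀ z, prob (groverExact f t) (some z) = if (f z).val then
      ∑ b, ENNReal.ofReal (‖(groverState (ancillaState D (exactAngle (Fintype.card D) t))
        (fun x => (ancillaPredicate f x).val) (exactIterations (Fintype.card D) t)).1
          (z, b)‖ ^ 2) else 0 := by
    intro z
    rw [prob_eq_expect, expect_groverExact, Fintype.sum_prod_type, Finset.sum_eq_single z]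
    · by_cases h : (f z).val <;> simp [h]
    · intro x _ hx
      by_cases h : (f x).val <;> simp [h, hx]
    · simp
  constructor
  · intro z hz
    rw [key, if_neg hz]
  · intro z z' hz hz'
    rw [key, key, if_pos hz, if_pos hz']
    refine Finset.sum_congr rfl fun b _ => ?_
    rw [groverState_congr (ancillaState D (exactAngle (Fintype.card D) t))
      (fun x => (ancillaPredicate f x).val) _ (x := (z, b)) (y := (z', b))
      (by simp only [ancillaPredicate_val, hz, hz']) rfl]

theorem registerCost_prod_bool : registerCost (D × Bool) = registerCost D + 1 := by
  unfold registerCost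
  rw [Fintype.card_prod, Fintype.card_bool]
  congr 1
  have h : 1 < Fintype.card D * 2 := by
    have := Fintype.card_pos (α := D)
    omega
  rw [Nat.clog_of_two_le one_lt_two h]
  congr 2
  omega

theorem le_arcsin {x : ℝ} (h0 : 0 ≤ x) (h1 : x ≤ 1) : x ≤ Real.arcsin x := by
  calc x = Real.sin (Real.arcsin x) := (Real.sin_arcsin (by linarith) h1).symm
    _ ≤ _ := Real.sin_le (Real.arcsin_nonneg.mpr h0)

theorem one_le_sqrt_div {N t : ℕ} (ht : 0 < t) (htN : t ≤ N) :
    1 ≤ Real.sqrt ((N : ℝ) / t) := by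
  rw [Real.one_le_sqrt, one_le_div (by exact_mod_cast ht)]
  exact_mod_cast htN

/-- From `x ≤ arcsin x` and `π ≤ 4`; the rounding and the additional iteration are absorbed by
`√(N/t) ≥ 1`. -/
theorem exactIterations_add_one_le {N t : ℕ} (ht : 0 < t) (htN : t ≤ N) :
    (exactIterations N t : ℝ) + 1 ≤ 3 * Real.sqrt (N / t) := by
  have ht' : (0 : ℝ) < t := by exact_mod_cast ht
  have hN' : (0 : ℝ) < N := by exact_mod_cast ht.trans_le htN
  have h1 := one_le_sqrt_div ht htN
  have hx1 : Real.sqrt ((t : ℝ) / N) ≤ 1 := by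
    rw [Real.sqrt_le_one, div_le_one hN']
    exact_mod_cast htN
  have hx0 : 0 < Real.sqrt ((t : ℝ) / N) := by positivity
  have ha := le_arcsin hx0.le hx1
  have hinv : (Real.sqrt ((t : ℝ) / N))⁻¹ = Real.sqrt (N / t) := by
    rw [← Real.sqrt_inv, inv_div]
  have hb : Real.pi / (4 * Real.arcsin (Real.sqrt (t / N))) ≤ Real.sqrt (N / t) := by
    rw [← hinv, div_le_iff₀ (by linarith), inv_mul_eq_div, le_div_iff₀ hx0]
    calc Real.pi * Real.sqrt ((t : ℝ) / N) ≤ 4 * Real.sqrt ((t : ℝ) / N) := by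
          gcongr; exact Real.pi_le_four
      _ ≤ _ := by gcongr
  have hc : (exactIterations N t : ℝ) ≤ Real.sqrt (N / t) + 1 := by
    rcases le_total (Real.pi / (4 * Real.arcsin (Real.sqrt (t / N))) - 1 / 2) 0 with h | h
    · unfold exactIterations
      rw [Nat.ceil_eq_zero.mpr h]
      push_cast
      positivity
    · unfold exactIterations
      linarith [Nat.ceil_lt_add_one h]
  linarith

theorem expectedTime_groverExact_le (f : D → Timed Bool) {t : ℕ} (ht : 0 < t)
    (htN : t ≤ Fintype.card D) :
    expectedTime (groverExact f t) ≤
      ENNReal.ofReal (3 * Real.sqrt (Fintype.card D / t) * searchUnit f) := by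
  have h : expectedTime (groverExact f t) ≤
      (((exactIterations (Fintype.card D) t + 1) * searchUnit f : ℕ) : ℝ≥0∞) := by
    rw [groverExact_eq, expectedTime_bind, expectedTime_groverMeasure]
    simp only [expectedTime_bind, expectedTime_run, expectedTime_pure, expect_const, add_zero]
    refine (add_le_add_right (expect_le_const (r := (worstTime f : ℝ≥0∞)) _ fun x => ?_) _).trans ?_
    · exact_mod_cast time_le_worstTime f x.1
    · norm_cast
      rw [registerCost_prod_bool]
      have h := worstTime_ancillaPredicate_le f
      have h2 : exactIterations (Fintype.card D) t *
          (2 * worstTime (ancillaPredicate f) + 1 + 3 * (registerCost D + 1)) ≤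
          -- The auxiliary qubit adds one step to each of the two evaluations and three units of
          -- register cost: `2W + 3R + 6` per iteration, where `W` is the worst time and `R` the
          -- register cost. The constant in `searchUnit` leaves room for this.
          exactIterations (Fintype.card D) t * searchUnit f :=
        Nat.mul_le_mul_left _ (by unfold searchUnit; omega)
      rw [add_mul, one_mul]
      unfold searchUnit at *
      omega
  refine h.trans ?_
  rw [← ENNReal.ofReal_natCast]
  refine ENNReal.ofReal_le_ofReal ?_
  push_cast
  gcongr
  exact exactIterations_add_one_le ht htN

theorem ancillaState_norm_sq (β : ℝ) (x : D × Bool) :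
    ‖(ancillaState D β).1 x‖ ^ 2 =
      ((Fintype.card D : ℝ))⁻¹ * (if x.2 then Real.sin β else Real.cos β) ^ 2 := by
  have h : (ancillaState D β).1 x = (((Real.sqrt (Fintype.card D))⁻¹ *
    (if x.2 then Real.sin β else Real.cos β) : ℝ) : ℂ) := rfl
  rw [h, Complex.norm_real, Real.norm_eq_abs, sq_abs, mul_pow, inv_pow,
    Real.sq_sqrt (by positivity)]

/-- The argument of `arcsin` in `exactAngle` is at most one: rounding the number `m` of iterations
up makes `π/(4m+2)` at most the angle `arcsin √(t/N)`, so the amplitude only has to be lowered. -/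
theorem sin_exactAngle {N t : ℕ} (ht : 0 < t) (htN : t ≤ N) :
    Real.sin (exactAngle N t) =
      Real.sqrt (N / t) * Real.sin (Real.pi / (4 * exactIterations N t + 2)) := by
  have ht' : (0 : ℝ) < t := by exact_mod_cast ht
  have hN' : (0 : ℝ) < N := by exact_mod_cast ht.trans_le htN
  have hx1 : Real.sqrt ((t : ℝ) / N) ≤ 1 := by
    rw [Real.sqrt_le_one, div_le_one hN']
    exact_mod_cast htN
  have hx0 : 0 < Real.sqrt ((t : ℝ) / N) := by positivity
  have ha : 0 < Real.arcsin (Real.sqrt ((t : ℝ) / N)) := hx0.trans_le (le_arcsin hx0.le hx1)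
  set m := exactIterations N t with hm
  have hpos : (0 : ℝ) < 4 * m + 2 := by positivity
  have hle : Real.pi / (4 * m + 2) ≤ Real.arcsin (Real.sqrt ((t : ℝ) / N)) := by
    have h1 : Real.pi / (4 * Real.arcsin (Real.sqrt (t / N))) - 1 / 2 ≤ m := Nat.le_ceil _
    rw [sub_le_iff_le_add, div_le_iff₀ (by positivity)] at h1
    rw [div_le_iff₀ hpos]
    linarith
  have hs0 : 0 ≤ Real.sin (Real.pi / (4 * m + 2)) := by
    refine Real.sin_nonneg_of_nonneg_of_le_pi (by positivity) (div_le_self Real.pi_pos.le ?_)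
    have : (0 : ℝ) ≤ m := by positivity
    linarith
  have hs : Real.sin (Real.pi / (4 * m + 2)) ≤ Real.sqrt ((t : ℝ) / N) := by
    calc _ ≤ Real.sin (Real.arcsin (Real.sqrt ((t : ℝ) / N))) := by
          refine Real.sin_le_sin_of_le_of_le_pi_div_two ?_ (Real.arcsin_le_pi_div_two _) hle
          exact le_trans (by linarith [Real.pi_pos]) (show 0 ≤ Real.pi / (4 * (m : ℝ) + 2) by
            positivity)
      _ = _ := Real.sin_arcsin (by linarith) hx1
  refine Real.sin_arcsin (le_trans (by norm_num) (mul_nonneg (Real.sqrt_nonneg _) hs0)) ?_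
  calc Real.sqrt ((N : ℝ) / t) * Real.sin (Real.pi / (4 * m + 2))
      ≤ Real.sqrt ((N : ℝ) / t) * Real.sqrt ((t : ℝ) / N) := by gcongr
    _ = 1 := by
      rw [← Real.sqrt_mul (by positivity), div_mul_div_comm, mul_comm, div_self (by positivity),
        Real.sqrt_one]

/-- The auxiliary qubit turns the initial angle into `π/(4m+2)`, and `m` iterations multiply it by
`2m+1`, which gives exactly `π/2`. -/
theorem prob_groverExact_none (f : D → Timed Bool) (ht : 0 < solCount f) :
    prob (groverExact f (solCount f)) none = 0 := by
  classical
  set t := solCount f with htdef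
  set N := Fintype.card D with hN
  have htN : t ≤ N := solCount_le_card f
  have ht' : (0 : ℝ) < t := by exact_mod_cast ht
  have hN' : (0 : ℝ) < N := by exact_mod_cast ht.trans_le htN
  set m := exactIterations N t with hm
  have hangle : ∑ x, (if (ancillaPredicate f x).val then
      ‖(ancillaState D (exactAngle N t)).1 x‖ ^ 2 else 0) =
        Real.sin (Real.pi / (4 * m + 2)) ^ 2 := by
    simp only [ancillaState_norm_sq, ancillaPredicate_val]
    rw [Fintype.sum_prod_type]
    simp only [Fintype.sum_bool, Bool.and_true, Bool.and_false, if_true, Bool.false_eq_true,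
      if_false, add_zero]
    rw [← Finset.sum_filter, Finset.sum_const, nsmul_eq_mul, sin_exactAngle ht htN, mul_pow,
      Real.sq_sqrt (by positivity)]
    change (t : ℝ) * _ = _
    rw [← hN, ← hm]
    field_simp
  have hle := sum_unmarked_groverState_le (ancillaState D (exactAngle N t))
    (fun x => (ancillaPredicate f x).val) (Real.pi / (4 * m + 2)) hangle m
  have hcos : Real.cos ((2 * m + 1) * (Real.pi / (4 * m + 2))) = 0 := by
    rw [show (2 * (m : ℝ) + 1) * (Real.pi / (4 * m + 2)) = Real.pi / 2 by field_simp; ring]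
    exact Real.cos_pi_div_two
  rw [hcos, zero_pow two_ne_zero, ENNReal.ofReal_zero] at hle
  rw [← nonpos_iff_eq_zero]
  refine le_trans ?_ hle
  rw [prob_eq_expect, expect_groverExact]
  -- A solution measured with auxiliary qubit `0` is unmarked but accepted all the same, hence an
  -- inequality.
  refine Finset.sum_le_sum fun x _ => mul_le_mul_right ?_ _
  rw [ancillaPredicate_val]
  by_cases h : (f x.1).val <;> simp [h]

end Search

/-! ### Chains of searches: real bounds for time and failure -/

theorem add_mul_le_ofReal {E q E' : ℝ≥0∞} {a b c d : ℝ} (hE : E ≤ ENNReal.ofReal a)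
    (hq : q ≤ ENNReal.ofReal b) (hE' : E' ≤ ENNReal.ofReal c) (ha : 0 ≤ a) (hb : 0 ≤ b)
    (hc : 0 ≤ c) (h : a + b * c ≤ d) : E + q * E' ≤ ENNReal.ofReal d := by
  refine le_trans ?_ (ENNReal.ofReal_le_ofReal h)
  rw [ENNReal.ofReal_add ha (mul_nonneg hb hc), ENNReal.ofReal_mul hb]
  gcongr

theorem prob_none_firstSuccess_append {α : Type} (l l' : List (RandTimed (Option α))) :
    prob (firstSuccess (l ++ l')) none =
      prob (firstSuccess l) none * prob (firstSuccess l') none := by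
  simp only [prob_none_firstSuccess, List.map_append, List.prod_append]

section Search

variable {D : Type} [Fintype D] [Nonempty D]

theorem card_pos_real : (0 : ℝ) < Fintype.card D := by exact_mod_cast Fintype.card_pos

/-! ## The algorithm *BBHT* -/

/-- The part of *BBHT* that consists of `k` rounds beginning with `m = (8 / 7) ^ s`. -/
noncomputable def bbhtRounds (f : D → Timed Bool) (s k : ℕ) : RandTimed (Option D) :=
  firstSuccess ((List.range' s k).map fun s => groverRandom f ((8 / 7 : ℝ) ^ s))

theorem bbht_eq (f : D → Timed Bool) :
    bbht f = bbhtRounds f 0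
      (⌊Real.logb (8 / 7) (2 * Real.sqrt (Fintype.card D))⌋₊ + 1) := by
  rw [bbht, bbhtRounds, List.range_eq_range']

theorem bbhtRounds_succ (f : D → Timed Bool) (s k : ℕ) :
    bbhtRounds f s (k + 1) = firstSuccess (groverRandom f ((8 / 7 : ℝ) ^ s) ::
      (List.range' (s + 1) k).map fun s => groverRandom f ((8 / 7 : ℝ) ^ s)) := by
  rw [bbhtRounds, List.range'_succ, List.map_cons]

/-- A geometric sum: with `λ = 8/7`, a round costs `2 λ^s = 14 (λ^(s+1) - λ^s)` units. -/
theorem expectedTime_bbhtRounds_le (f : D → Timed Bool) (s k : ℕ) :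
    expectedTime (bbhtRounds f s k) ≤
      ENNReal.ofReal (14 * ((8 / 7 : ℝ) ^ (s + k) - (8 / 7) ^ s) * searchUnit f) := by
  induction k generalizing s with
  | zero => exact (expectedTime_firstSuccess_nil (α := D)).le.trans zero_le
  | succ k ih =>
    rw [bbhtRounds_succ, expectedTime_firstSuccess_cons]
    have hmono : (8 / 7 : ℝ) ^ (s + 1) ≤ (8 / 7) ^ (s + 1 + k) :=
      pow_le_pow_right₀ (by norm_num) (by omega)
    refine add_mul_le_ofReal
      (expectedTime_groverRandom_le f (one_le_pow₀ (by norm_num)))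
      ((prob_le_one _ _).trans ENNReal.ofReal_one.ge) (ih (s + 1)) (by positivity) (by norm_num)
      (mul_nonneg (by linarith) (by positivity)) (le_of_eq ?_)
    rw [show s + (k + 1) = s + 1 + k by ring, pow_succ (8 / 7 : ℝ) s]
    ring

/-- Let `x = √(N/t)` and `λ = 8/7`. Once `λ^s ≥ x`, a round is followed by another with probability
at most `3/4`, and `14` solves `c = 2 + (3/4) λ c`; this works because `3λ/4 < 1`. Earlier rounds
are paid in full by the increase of `14 λ^s`. The factor `32` comes from the passage between the two
regimes, where `2 λ^s + 14 λ^(s+1) = 18 λ^s` must be at most `32 x - 14 λ^s`. -/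
theorem expectedTime_bbhtRounds_le_of_solution (f : D → Timed Bool) (ht : 0 < solCount f)
    (s k : ℕ) :
    expectedTime (bbhtRounds f s k) ≤
      ENNReal.ofReal ((if Real.sqrt (Fintype.card D / solCount f) ≤ (8 / 7 : ℝ) ^ s
        then 14 * (8 / 7 : ℝ) ^ s
        else 32 * Real.sqrt (Fintype.card D / solCount f) - 14 * (8 / 7 : ℝ) ^ s) *
          searchUnit f) := by
  set x := Real.sqrt (Fintype.card D / solCount f) with hx
  have hB : (0 : ℝ) ≤ searchUnit f := by positivity
  induction k generalizing s with
  | zero => exact (expectedTime_firstSuccess_nil (α := D)).le.trans zero_le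
  | succ k ih =>
    rw [bbhtRounds_succ, expectedTime_firstSuccess_cons]
    have hpos : (0 : ℝ) < (8 / 7) ^ s := by positivity
    have hsucc : (8 / 7 : ℝ) ^ (s + 1) = 8 / 7 * (8 / 7) ^ s := pow_succ' _ _
    have hnn : 0 ≤ (if x ≤ (8 / 7 : ℝ) ^ (s + 1) then 14 * (8 / 7 : ℝ) ^ (s + 1)
        else 32 * x - 14 * (8 / 7 : ℝ) ^ (s + 1)) * searchUnit f := by
      refine mul_nonneg ?_ hB
      split_ifs with h
      · positivity
      · linarith
    have hE := expectedTime_groverRandom_le f (m := (8 / 7 : ℝ) ^ s) (one_le_pow₀ (by norm_num))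
    by_cases h : x ≤ (8 / 7 : ℝ) ^ s
    · refine add_mul_le_ofReal hE (prob_groverRandom_none_le f ht h) (ih (s + 1))
        (by positivity) (by norm_num) hnn (le_of_eq ?_)
      rw [if_pos h, if_pos (by linarith), hsucc]
      ring
    · refine add_mul_le_ofReal hE ((prob_le_one _ _).trans ENNReal.ofReal_one.ge) (ih (s + 1))
        (by positivity) (by norm_num) hnn ?_
      rw [if_neg h, one_mul, ← add_mul]
      refine mul_le_mul_of_nonneg_right ?_ hB
      split_ifs with h'
      · linarith
      · linarith

/-- Past the threshold, a round multiplies the failure probability by `3/4 ≤ (7/8)²`, so this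
probability decays at least as fast as `m⁻²`. The maximum accounts for a start below the threshold,
since the first effective `m` is then at most `8/7` times it. -/
theorem prob_bbhtRounds_none_le (f : D → Timed Bool) (ht : 0 < solCount f) (s k : ℕ) :
    prob (bbhtRounds f s k) none ≤
      ENNReal.ofReal ((max ((8 / 7 : ℝ) ^ s)
        (8 / 7 * Real.sqrt (Fintype.card D / solCount f)) / (8 / 7) ^ (s + k)) ^ 2) := by
  set x := Real.sqrt (Fintype.card D / solCount f) with hx
  have hx0 : 0 ≤ x := Real.sqrt_nonneg _
  induction k generalizing s with
  | zero =>
    refine (prob_le_one _ _).trans ?_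
    rw [← ENNReal.ofReal_one]
    refine ENNReal.ofReal_le_ofReal (one_le_pow₀ ?_)
    rw [one_le_div (by positivity)]
    exact le_max_left _ _
  | succ k ih =>
    rw [bbhtRounds_succ, prob_none_firstSuccess_cons]
    have hpos : (0 : ℝ) < (8 / 7) ^ s := by positivity
    have hsucc : (8 / 7 : ℝ) ^ (s + 1) = 8 / 7 * (8 / 7) ^ s := pow_succ' _ _
    have ih' := ih (s + 1)
    rw [show s + 1 + k = s + (k + 1) by ring] at ih'
    by_cases h : x ≤ (8 / 7 : ℝ) ^ s
    · refine (mul_le_mul' (prob_groverRandom_none_le f ht h) ih').trans ?_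
      rw [← ENNReal.ofReal_mul (by norm_num)]
      refine ENNReal.ofReal_le_ofReal ?_
      rw [max_eq_left (by rw [hsucc]; linarith), hsucc, mul_div_assoc, mul_pow, ← mul_assoc]
      -- The factor is `(3/4)(8/7)² = 48/49`.
      refine (mul_le_of_le_one_left (by positivity) (by norm_num)).trans ?_
      gcongr
      exact le_max_left _ _
    · refine (mul_le_of_le_one_left' (prob_le_one _ _)).trans (ih'.trans ?_)
      refine ENNReal.ofReal_le_ofReal ?_
      gcongr ?_ ^ 2
      rw [max_eq_right (by rw [hsucc]; linarith)]
      gcongr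
      exact le_max_right _ _

theorem bbht_last_round : (8 / 7 : ℝ) ^
      ⌊Real.logb (8 / 7) (2 * Real.sqrt (Fintype.card D))⌋₊ ≤ 2 * Real.sqrt (Fintype.card D) ∧
    2 * Real.sqrt (Fintype.card D) <
      (8 / 7 : ℝ) ^ (⌊Real.logb (8 / 7) (2 * Real.sqrt (Fintype.card D))⌋₊ + 1) := by
  have hN := card_pos_real (D := D)
  have hone : 1 ≤ Real.sqrt (Fintype.card D) := by
    rw [Real.one_le_sqrt]
    exact_mod_cast Nat.succ_le_of_lt Fintype.card_pos
  have h0 : 0 ≤ Real.logb (8 / 7) (2 * Real.sqrt (Fintype.card D)) :=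
    Real.logb_nonneg (by norm_num) (by linarith)
  constructor
  · rw [← Real.rpow_natCast, ← Real.le_logb_iff_rpow_le (by norm_num) (by linarith)]
    exact Nat.floor_le h0
  · rw [← Real.rpow_natCast, ← Real.logb_lt_iff_lt_rpow (by norm_num) (by linarith)]
    push_cast
    exact Nat.lt_floor_add_one _

theorem expectedTime_bbht_le (f : D → Timed Bool) :
    expectedTime (bbht f) ≤ ENNReal.ofReal (32 * Real.sqrt (Fintype.card D) * searchUnit f) := by
  rw [bbht_eq]
  refine (expectedTime_bbhtRounds_le f 0 _).trans (ENNReal.ofReal_le_ofReal ?_)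
  refine mul_le_mul_of_nonneg_right ?_ (by positivity)
  rw [zero_add, pow_succ, pow_zero]
  -- `14 · (8/7) · 2 = 32`.
  linarith [(bbht_last_round (D := D)).1]

theorem expectedTime_bbht_le_of_solution (f : D → Timed Bool) (ht : 0 < solCount f) :
    expectedTime (bbht f) ≤
      ENNReal.ofReal (32 * Real.sqrt (Fintype.card D / solCount f) * searchUnit f) := by
  rw [bbht_eq]
  refine (expectedTime_bbhtRounds_le_of_solution f ht 0 _).trans (ENNReal.ofReal_le_ofReal ?_)
  have h1 := one_le_sqrt_div ht (solCount_le_card f)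
  gcongr
  rw [pow_zero]
  split_ifs <;> linarith

/-- The first `m` beyond the schedule exceeds `2√N`, so the quadratic decay leaves at most
`((8/7)/2)² / t`. -/
theorem prob_bbht_none_le (f : D → Timed Bool) (ht : 0 < solCount f) :
    prob (bbht f) none ≤ ENNReal.ofReal (1 / solCount f) := by
  rw [bbht_eq]
  refine (prob_bbhtRounds_none_le f ht 0 _).trans (ENNReal.ofReal_le_ofReal ?_)
  have h1 := one_le_sqrt_div ht (solCount_le_card f)
  have ht' : (0 : ℝ) < solCount f := by exact_mod_cast ht
  have hN := card_pos_real (D := D)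
  rw [pow_zero, max_eq_right (by linarith), zero_add]
  calc (8 / 7 * Real.sqrt (Fintype.card D / solCount f) / (8 / 7 : ℝ) ^
        (⌊Real.logb (8 / 7) (2 * Real.sqrt (Fintype.card D))⌋₊ + 1)) ^ 2
      ≤ (8 / 7 * Real.sqrt (Fintype.card D / solCount f) /
          (2 * Real.sqrt (Fintype.card D))) ^ 2 := by
        gcongr
        exact (bbht_last_round (D := D)).2.le
    _ = 16 / 49 * (1 / (solCount f : ℝ)) := by
        rw [div_pow, mul_pow, mul_pow, Real.sq_sqrt (by positivity), Real.sq_sqrt hN.le]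
        field_simp
        norm_num
    _ ≤ _ := mul_le_of_le_one_left (by positivity) (by norm_num)

theorem isUnbiased_bbht (f : D → Timed Bool) :
    IsUnbiased (fun x => (f x).val = true) (bbht f) := by
  refine IsUnbiased.firstSuccess fun c hc => ?_
  obtain ⟨s, -, rfl⟩ := List.mem_map.mp hc
  exact isUnbiased_groverRandom f _

/-! ## The algorithm *BCWZ* -/

/-- The number `⌈lg ε⁻¹⌉`. -/
noncomputable def logInv (ε : ℝ) : ℕ := ⌈Real.logb 2 ε⁻¹⌉₊

theorem bcwz_eq (ε : ℝ) (f : D → Timed Bool) :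
    bcwz ε f = firstSuccess
      ((List.range (min (logInv ε) (Fintype.card D))).map (fun t => groverExact f (t + 1)) ++
        if logInv ε < Fintype.card D then
          List.replicate (3 * logInv ε)
            (groverRandom f (Real.sqrt (Fintype.card D / logInv ε)))
        else []) := rfl

theorem one_le_logb_inv {ε : ℝ} (h0 : 0 < ε) (h1 : ε ≤ 1 / 2) : 1 ≤ Real.logb 2 ε⁻¹ := by
  rw [Real.le_logb_iff_rpow_le one_lt_two (by positivity), Real.rpow_one,
    le_inv_comm₀ two_pos h0]
  linarith

theorem logInv_pos {ε : ℝ} (h0 : 0 < ε) (h1 : ε ≤ 1 / 2) : 0 < logInv ε :=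
  Nat.ceil_pos.mpr (by linarith [one_le_logb_inv h0 h1])

theorem half_pow_logInv_le {ε : ℝ} (h0 : 0 < ε) : (1 / 2 : ℝ) ^ logInv ε ≤ ε := by
  have h : Real.logb 2 ε⁻¹ ≤ logInv ε := Nat.le_ceil _
  rw [Real.logb_le_iff_le_rpow one_lt_two (by positivity), Real.rpow_natCast] at h
  rw [one_div, inv_pow]
  exact inv_le_of_inv_le₀ h0 h

theorem isUnbiased_bcwz (ε : ℝ) (f : D → Timed Bool) :
    IsUnbiased (fun x => (f x).val = true) (bcwz ε f) := by
  rw [bcwz_eq]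
  refine IsUnbiased.firstSuccess fun c hc => ?_
  rcases List.mem_append.mp hc with hc | hc
  · obtain ⟨t, -, rfl⟩ := List.mem_map.mp hc
    exact isUnbiased_groverExact f _
  · split_ifs at hc
    · rw [List.eq_of_mem_replicate hc]
      exact isUnbiased_groverRandom f _
    · simp at hc

/-- The sum of `1/√t` for `t ≤ k` is at most `2√k`, by comparison with the differences of `2√t`. -/
theorem sum_expectedTime_groverExact_le (f : D → Timed Bool) (k : ℕ) (hk : k ≤ Fintype.card D) :
    (((List.range k).map fun t => groverExact f (t + 1)).map expectedTime).sum ≤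
      ENNReal.ofReal (6 * Real.sqrt (Fintype.card D * k) * searchUnit f) := by
  induction k with
  | zero => simp
  | succ k ih =>
    rw [List.range_succ, List.map_append, List.map_append, List.sum_append]
    refine (add_le_add (ih (by omega)) (by
      simpa using expectedTime_groverExact_le f (Nat.succ_pos k) hk)).trans ?_
    rw [← ENNReal.ofReal_add (by positivity) (by positivity), ← add_mul]
    refine ENNReal.ofReal_le_ofReal (mul_le_mul_of_nonneg_right ?_ (by positivity))
    have hk0 : (0 : ℝ) ≤ k := by positivity
    have hk1 : (0 : ℝ) < (k : ℝ) + 1 := by positivity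
    rw [Real.sqrt_mul (by positivity), Real.sqrt_mul (by positivity),
      Nat.cast_succ]
    have key : 6 * Real.sqrt k + 3 / Real.sqrt ((k : ℝ) + 1) ≤ 6 * Real.sqrt ((k : ℝ) + 1) := by
      have hp : 0 < Real.sqrt ((k : ℝ) + 1) := Real.sqrt_pos.mpr hk1
      have hs := Real.sq_sqrt hk0
      have hs1 := Real.sq_sqrt hk1.le
      rw [← le_sub_iff_add_le', div_le_iff₀ hp]
      nlinarith [sq_nonneg (Real.sqrt ((k : ℝ) + 1) - Real.sqrt k)]
    calc _ = Real.sqrt (Fintype.card D) *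
          (6 * Real.sqrt k + 3 / Real.sqrt ((k : ℝ) + 1)) := by ring
      _ ≤ Real.sqrt (Fintype.card D) * (6 * Real.sqrt ((k : ℝ) + 1)) := by gcongr
      _ = _ := by ring

theorem expectedTime_bcwz_le {ε : ℝ} (h0 : 0 < ε) (h1 : ε ≤ 1 / 2) (f : D → Timed Bool) :
    expectedTime (bcwz ε f) ≤
      ENNReal.ofReal (12 * Real.sqrt (Fintype.card D * logInv ε) * searchUnit f) := by
  have hN := card_pos_real (D := D)
  have ht : (0 : ℝ) < logInv ε := by exact_mod_cast logInv_pos h0 h1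
  rw [bcwz_eq]
  refine (expectedTime_firstSuccess_le _).trans ?_
  rw [List.map_append, List.sum_append]
  have hA : (((List.range (min (logInv ε) (Fintype.card D))).map
      fun t => groverExact f (t + 1)).map expectedTime).sum ≤
      ENNReal.ofReal (6 * Real.sqrt (Fintype.card D * logInv ε) * searchUnit f) := by
    refine (sum_expectedTime_groverExact_le f _ (min_le_right _ _)).trans
      (ENNReal.ofReal_le_ofReal ?_)
    gcongr
    exact min_le_left _ _
  have hB : ((if logInv ε < Fintype.card D then List.replicate (3 * logInv ε)
        (groverRandom f (Real.sqrt (Fintype.card D / logInv ε))) else []).map expectedTime).sum ≤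
      ENNReal.ofReal (6 * Real.sqrt (Fintype.card D * logInv ε) * searchUnit f) := by
    split_ifs with h
    · rw [List.map_replicate, List.sum_replicate, nsmul_eq_mul]
      refine (mul_le_mul_right (expectedTime_groverRandom_le f
        (one_le_sqrt_div (logInv_pos h0 h1) h.le)) _).trans ?_
      rw [← ENNReal.ofReal_natCast, ← ENNReal.ofReal_mul (by positivity)]
      refine ENNReal.ofReal_le_ofReal (le_of_eq ?_)
      push_cast
      rw [Real.sqrt_div hN.le, Real.sqrt_mul hN.le]
      have hs := Real.sq_sqrt ht.le
      have hsp : Real.sqrt (logInv ε) ≠ 0 := (Real.sqrt_pos.mpr ht).ne'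
      field_simp
      rw [hs]
      ring
    · simp
  refine (add_le_add hA hB).trans ?_
  rw [← ENNReal.ofReal_add (by positivity) (by positivity)]
  exact ENNReal.ofReal_le_ofReal (by linarith)

/-- One of the exact searches assumes the true number of solutions. -/
theorem prob_bcwz_none_eq_zero {ε : ℝ} (f : D → Timed Bool) (ht : 0 < solCount f)
    (h : solCount f ≤ logInv ε) : prob (bcwz ε f) none = 0 := by
  rw [bcwz_eq, prob_none_firstSuccess_append]
  refine mul_eq_zero_of_left ?_ _
  rw [prob_none_firstSuccess]
  refine List.prod_eq_zero (List.mem_map.mpr ⟨groverExact f (solCount f), ?_,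
    prob_groverExact_none f ht⟩)
  refine List.mem_map.mpr ⟨solCount f - 1, ?_, ?_⟩
  · rw [List.mem_range, lt_min_iff]
    have := solCount_le_card f
    omega
  · rw [Nat.sub_add_cancel ht]

/-- With more than `t₀` solutions, `√(N/t₀)` is a sufficient range for each random search, and three
of them fail together with probability at most `(3/4)³ ≤ 1/2`. -/
theorem prob_bcwz_none_le {ε : ℝ} (h0 : 0 < ε) (h1 : ε ≤ 1 / 2) (f : D → Timed Bool)
    (h : logInv ε < solCount f) : prob (bcwz ε f) none ≤ ENNReal.ofReal ε := by
  have hlt : logInv ε < Fintype.card D := h.trans_le (solCount_le_card f)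
  have ht : (0 : ℝ) < logInv ε := by exact_mod_cast logInv_pos h0 h1
  rw [bcwz_eq, prob_none_firstSuccess_append, if_pos hlt]
  refine (mul_le_of_le_one_left' (prob_le_one _ _)).trans ?_
  rw [prob_none_firstSuccess, List.map_replicate, List.prod_replicate]
  calc prob (groverRandom f (Real.sqrt (Fintype.card D / logInv ε))) none ^ (3 * logInv ε)
      ≤ ENNReal.ofReal (3 / 4) ^ (3 * logInv ε) := by
        gcongr
        refine prob_groverRandom_none_le f ((Nat.zero_le _).trans_lt h) ?_
        gcongr
    _ = ENNReal.ofReal (((3 / 4) ^ 3) ^ logInv ε) := by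
        rw [← ENNReal.ofReal_pow (by norm_num), pow_mul]
    _ ≤ _ := by
        refine ENNReal.ofReal_le_ofReal (le_trans ?_ (half_pow_logInv_le h0))
        gcongr
        norm_num

/-! ## The algorithm *findsol* -/

theorem isUnbiased_findsol (ε : ℝ) (f : D → Timed Bool) :
    IsUnbiased (fun x => (f x).val = true) (findsol ε f) := by
  refine IsUnbiased.firstSuccess fun c hc => ?_
  simp only [List.mem_cons, List.not_mem_nil, or_false] at hc
  rcases hc with rfl | rfl | rfl
  · exact isUnbiased_bbht f
  · exact isUnbiased_bbht f
  · exact isUnbiased_bcwz ε f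

theorem prob_findsol_none_eq (ε : ℝ) (f : D → Timed Bool) :
    prob (findsol ε f) none =
      prob (bbht f) none * (prob (bbht f) none * prob (bcwz ε f) none) := by
  rw [findsol, prob_none_firstSuccess]
  simp

theorem prob_findsol_none_eq_zero {ε : ℝ} (f : D → Timed Bool) (ht : 0 < solCount f)
    (h : solCount f ≤ logInv ε) : prob (findsol ε f) none = 0 := by
  rw [prob_findsol_none_eq, prob_bcwz_none_eq_zero f ht h, mul_zero, mul_zero]

/-- One run of *BBHT* contributes `1/t`, and *BCWZ* contributes `ε`. The factor `1/t` keeps the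
failures of all rounds of *minfind* together below `ε`. -/
theorem prob_findsol_none_le {ε : ℝ} (h0 : 0 < ε) (h1 : ε ≤ 1 / 2) (f : D → Timed Bool)
    (h : logInv ε < solCount f) :
    prob (findsol ε f) none ≤ ENNReal.ofReal (1 / solCount f * ε) := by
  rw [prob_findsol_none_eq, ENNReal.ofReal_mul (by positivity)]
  refine (mul_le_of_le_one_left' (prob_le_one _ _)).trans ?_
  gcongr
  · exact prob_bbht_none_le f ((Nat.zero_le _).trans_lt h)
  · exact prob_bcwz_none_le h0 h1 f h

theorem expectedTime_findsol_eq (ε : ℝ) (f : D → Timed Bool) :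
    expectedTime (findsol ε f) = expectedTime (bbht f) + prob (bbht f) none *
      (expectedTime (bbht f) + prob (bbht f) none * expectedTime (bcwz ε f)) := by
  rw [findsol]
  simp only [expectedTime_firstSuccess_cons, expectedTime_firstSuccess_nil, mul_zero, add_zero]

theorem expectedTime_findsol_le {ε : ℝ} (h0 : 0 < ε) (h1 : ε ≤ 1 / 2) (f : D → Timed Bool) :
    expectedTime (findsol ε f) ≤
      ENNReal.ofReal (76 * Real.sqrt (Fintype.card D * logInv ε) * searchUnit f) := by
  have ht : (1 : ℝ) ≤ logInv ε := by exact_mod_cast logInv_pos h0 h1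
  have hN := card_pos_real (D := D)
  have hle : Real.sqrt (Fintype.card D) ≤ Real.sqrt (Fintype.card D * logInv ε) :=
    Real.sqrt_le_sqrt (le_mul_of_one_le_right hN.le ht)
  have hA : expectedTime (bbht f) ≤
      ENNReal.ofReal (32 * Real.sqrt (Fintype.card D * logInv ε) * searchUnit f) :=
    (expectedTime_bbht_le f).trans (ENNReal.ofReal_le_ofReal (by gcongr))
  have hone : prob (bbht f) none ≤ ENNReal.ofReal 1 :=
    (prob_le_one _ _).trans ENNReal.ofReal_one.ge
  rw [expectedTime_findsol_eq]
  refine add_mul_le_ofReal hA hone (add_mul_le_ofReal hA hone (expectedTime_bcwz_le h0 h1 f)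
    (by positivity) one_pos.le (by positivity) le_rfl) (by positivity) one_pos.le
    (by positivity) (le_of_eq (by ring))

/-- *BCWZ* costs `√(N t₀)` whatever `t` is, but it is reached only after *BBHT* has failed; `1/t ≤
1/√t` for one of the two runs already suffices. -/
theorem expectedTime_findsol_le_of_solution {ε : ℝ} (h0 : 0 < ε) (h1 : ε ≤ 1 / 2)
    (f : D → Timed Bool) (hs : 0 < solCount f) :
    expectedTime (findsol ε f) ≤
      ENNReal.ofReal (76 * Real.sqrt (Fintype.card D * logInv ε) / Real.sqrt (solCount f) *
        searchUnit f) := by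
  have ht : (1 : ℝ) ≤ logInv ε := by exact_mod_cast logInv_pos h0 h1
  have hN := card_pos_real (D := D)
  have hs' : (1 : ℝ) ≤ solCount f := by exact_mod_cast hs
  have hsq : (0 : ℝ) < Real.sqrt (solCount f) := Real.sqrt_pos.mpr (by linarith)
  have hle : Real.sqrt (Fintype.card D / solCount f) ≤
      Real.sqrt (Fintype.card D * logInv ε) / Real.sqrt (solCount f) := by
    rw [Real.sqrt_div hN.le]
    gcongr
    exact le_mul_of_one_le_right hN.le ht
  have hA : expectedTime (bbht f) ≤ ENNReal.ofReal (32 * (Real.sqrt (Fintype.card D * logInv ε) /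
      Real.sqrt (solCount f)) * searchUnit f) :=
    (expectedTime_bbht_le_of_solution f hs).trans (ENNReal.ofReal_le_ofReal (by gcongr))
  have hone : prob (bbht f) none ≤ ENNReal.ofReal 1 :=
    (prob_le_one _ _).trans ENNReal.ofReal_one.ge
  have hp : prob (bbht f) none ≤ ENNReal.ofReal (1 / Real.sqrt (solCount f)) := by
    refine (prob_bbht_none_le f hs).trans (ENNReal.ofReal_le_ofReal ?_)
    gcongr
    exact Real.sqrt_le_self_iff.mpr (Or.inr hs')
  rw [expectedTime_findsol_eq]
  refine add_mul_le_ofReal hA hone (add_mul_le_ofReal hA hp (expectedTime_bcwz_le h0 h1 f)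
    (by positivity) (by positivity) (by positivity) le_rfl) (by positivity) one_pos.le
    (by positivity) (le_of_eq (by ring))

end Search

/-! ### Ranks and a single round of *minfind* -/

section Minfind

variable {D : Type}

/-- The predicate for which *minfind* calls *findsol*. -/
def below (F : D → Timed ℤ) (y x : D) : Timed Bool := do
  let w ← F x
  tick 1
  return decide (w < (F y).val)

theorem below_val (F : D → Timed ℤ) (y x : D) :
    (below F y x).val = true ↔ (F x).val < (F y).val :=
  decide_eq_true_iff

variable [Fintype D]

theorem solCount_below (F : D → Timed ℤ) (y : D) :
    solCount (below F y) = (Finset.univ.filter fun x => (F x).val < (F y).val).card := by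
  unfold solCount
  congr 1
  ext x
  simp [below_val]

theorem worstTime_below_le (F : D → Timed ℤ) (y : D) :
    worstTime (below F y) ≤ worstTime F + 1 :=
  Finset.sup_le fun x _ => Nat.add_le_add_right (time_le_worstTime F x) 1

/-- The rank drops strictly in every round, so `|D|` rounds are enough. -/
theorem solCount_below_lt {F : D → Timed ℤ} {y z : D} (h : (F z).val < (F y).val) :
    solCount (below F z) < solCount (below F y) := by
  rw [solCount_below, solCount_below]
  refine Finset.card_lt_card ((Finset.ssubset_iff_of_subset fun x hx => ?_).mpr ⟨z, ?_, ?_⟩)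
  · simp only [Finset.mem_filter_univ] at *
    exact hx.trans h
  · simpa using h
  · simp

/-- In a set closed downwards and sorted by value, the element in position `i`, counted from zero,
has at most `i` elements strictly below it; ties only lower the rank. The induction removes an
element of maximal value. -/
theorem sum_solCount_below_le (F : D → Timed ℤ) {h : ℕ → ℝ≥0∞} (hh : Monotone h) (s : Finset D)
    (hs : ∀ z ∈ s, ∀ x, (F x).val < (F z).val → x ∈ s) :
    ∑ z ∈ s, h (solCount (below F z)) ≤ ∑ i ∈ Finset.range s.card, h i := by
  classical
  induction s using Finset.induction_on_max_value (fun x => (F x).val) with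
  | empty => simp
  | insert a s ha hmax ih =>
    rw [Finset.sum_insert ha, Finset.card_insert_of_notMem ha, Finset.sum_range_succ, add_comm]
    refine add_le_add (ih fun z hz x hx => ?_) (hh ?_)
    · rcases Finset.mem_insert.mp (hs z (Finset.mem_insert_of_mem hz) x hx) with rfl | h
      · exact absurd hx (hmax z hz).not_gt
      · exact h
    · rw [solCount_below]
      refine Finset.card_le_card fun x hx => ?_
      rw [Finset.mem_filter_univ] at hx
      rcases Finset.mem_insert.mp (hs a (Finset.mem_insert_self a s) x hx) with rfl | h
      · exact absurd hx (lt_irrefl _)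
      · exact h

/-- A bound for `searchUnit` in all rounds of *minfind*. -/
def minfindUnit (F : D → Timed ℤ) : ℕ := 2 * worstTime F + 3 * registerCost D + 9

theorem searchUnit_below_le (F : D → Timed ℤ) (y : D) :
    searchUnit (below F y) ≤ minfindUnit F := by
  have := worstTime_below_le F y
  unfold searchUnit minfindUnit
  omega

variable [Nonempty D]

theorem minfindLoop_succ (ε : ℝ) (F : D → Timed ℤ) (k : ℕ) (y : D) :
    minfindLoop ε F (k + 1) y = run (F y) >>= fun v =>
      findsol ε (fun x => do
        let w ← F x
        tick 1
        return decide (w < v)) >>= fun r => match r with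
          | some y' => minfindLoop ε F k y'
          | none => pure y := rfl

theorem expect_minfindLoop_succ (ε : ℝ) (F : D → Timed ℤ) (k : ℕ) (y : D) (g : D → ℝ≥0∞) :
    expect (minfindLoop ε F (k + 1) y) g = prob (findsol ε (below F y)) none * g y +
      ∑ z, prob (findsol ε (below F y)) (some z) * expect (minfindLoop ε F k z) g := by
  rw [minfindLoop_succ, expect_bind, expect_run, expect_bind, expect_eq_tsum_prob, tsum_option,
    tsum_fintype]
  simp only [expect_pure]
  rfl

theorem expectedTime_minfindLoop_succ (ε : ℝ) (F : D → Timed ℤ) (k : ℕ) (y : D) :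
    expectedTime (minfindLoop ε F (k + 1) y) = (F y).time +
      (expectedTime (findsol ε (below F y)) +
        ∑ z, prob (findsol ε (below F y)) (some z) * expectedTime (minfindLoop ε F k z)) := by
  rw [minfindLoop_succ, expectedTime_bind, expectedTime_run, expect_run, expectedTime_bind,
    expect_eq_tsum_prob, tsum_option, tsum_fintype]
  simp only [expectedTime_pure, mul_zero, zero_add]
  rfl

/-- The next element is a uniformly random one of the elements with smaller values. -/
theorem sum_prob_findsol_mul_le (ε : ℝ) (F : D → Timed ℤ) (y : D) {h : ℕ → ℝ} (hh : Monotone h)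
    (h0 : ∀ i, 0 ≤ h i) (G : D → ℝ≥0∞)
    (hG : ∀ z, (F z).val < (F y).val → G z ≤ ENNReal.ofReal (h (solCount (below F z)))) :
    ∑ z, prob (findsol ε (below F y)) (some z) * G z ≤
      ENNReal.ofReal ((solCount (below F y) : ℝ)⁻¹ *
        ∑ i ∈ Finset.range (solCount (below F y)), h i) := by
  have hterm : ∀ z, prob (findsol ε (below F y)) (some z) * G z ≤
      if (F z).val < (F y).val then
        (solCount (below F y) : ℝ≥0∞)⁻¹ * ENNReal.ofReal (h (solCount (below F z))) else 0 := by
    intro z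
    have hz := (isUnbiased_findsol ε (below F y)).prob_some_le z
    simp only [below_val] at hz
    split_ifs at hz ⊢ with hlt
    · rw [solCount_below]
      exact mul_le_mul' hz (hG z hlt)
    · rw [nonpos_iff_eq_zero.mp hz, zero_mul]
  refine (Finset.sum_le_sum fun z _ => hterm z).trans ?_
  rw [← Finset.sum_filter, ← Finset.mul_sum]
  have hsum := sum_solCount_below_le F (h := fun i => ENNReal.ofReal (h i))
    (fun i j hij => ENNReal.ofReal_le_ofReal (hh hij))
    (Finset.univ.filter fun x => (F x).val < (F y).val) (fun z hz x hx => by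
      rw [Finset.mem_filter_univ] at *
      exact hx.trans hz)
  rw [← solCount_below] at hsum
  -- Without solutions the inverse is `∞` in `ℝ≥0∞`, but it multiplies a sum that is zero.
  rcases Nat.eq_zero_or_pos (solCount (below F y)) with ht | ht
  · rw [ht, Finset.sum_range_zero, nonpos_iff_eq_zero] at hsum
    rw [hsum, mul_zero]
    exact zero_le
  · rw [ENNReal.ofReal_mul (by positivity), ENNReal.ofReal_inv_of_pos (by exact_mod_cast ht),
      ENNReal.ofReal_natCast, ENNReal.ofReal_sum_of_nonneg fun i _ => h0 i]
    gcongr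

/-! ## The probability of failure of *minfind* -/

/-- The bound reproduces itself: a miss has probability at most `ε/t`, and the mean of the bound
over ranks `0, …, t - 1` is at most `(t - 1)ε/t`. The hypothesis on `k` excludes that the loop stops
for want of rounds. -/
theorem expect_minfindLoop_failure_le {ε : ℝ} (h0 : 0 < ε) (h1 : ε ≤ 1 / 2) (F : D → Timed ℤ)
    (k : ℕ) (y : D) (hk : solCount (below F y) < k) :
    expect (minfindLoop ε F k y) (fun z => if ∀ x, (F z).val ≤ (F x).val then 0 else 1) ≤
      ENNReal.ofReal (if solCount (below F y) ≤ logInv ε then 0 else ε) := by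
  induction k generalizing y with
  | zero => omega
  | succ k ih =>
    rw [expect_minfindLoop_succ]
    have hsum := sum_prob_findsol_mul_le ε F y (h := fun i => if i ≤ logInv ε then 0 else ε)
      (fun i j hij => by dsimp only; split_ifs <;> first | omega | linarith)
      (fun i => by split_ifs <;> linarith)
      (fun z => expect (minfindLoop ε F k z)
        (fun z => if ∀ x, (F z).val ≤ (F x).val then 0 else 1))
      (fun z hz => ih z (by have := solCount_below_lt hz; omega))
    refine (add_le_add_right hsum _).trans ?_
    rcases Nat.eq_zero_or_pos (solCount (below F y)) with ht | ht
    · have hmin : ∀ x, (F y).val ≤ (F x).val := by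
        rw [solCount_below, Finset.card_eq_zero, Finset.filter_eq_empty_iff] at ht
        exact fun x => not_lt.mp (ht (Finset.mem_univ x))
      simp [ht, hmin]
    · set t := solCount (below F y) with htdef
      have ht' : (0 : ℝ) < t := by exact_mod_cast ht
      by_cases hle : t ≤ logInv ε
      · rw [prob_findsol_none_eq_zero (below F y) ht hle, zero_mul, zero_add]
        refine ENNReal.ofReal_le_ofReal ?_
        rw [if_pos hle, Finset.sum_eq_zero, mul_zero]
        intro i hi
        rw [if_pos (by have := Finset.mem_range.mp hi; omega)]
      -- The term of rank `0` vanishes; the `ε` saved there pays for a miss in the present round.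
      · have hS : ∑ i ∈ Finset.range t, (if i ≤ logInv ε then 0 else ε) ≤ (t - 1) * ε := by
          obtain ⟨u, hu⟩ := Nat.exists_eq_succ_of_ne_zero ht.ne'
          rw [hu, Finset.sum_range_succ']
          refine (add_le_add (Finset.sum_le_card_nsmul _ _ ε fun i _ => ?_) le_rfl).trans ?_
          · split_ifs <;> linarith
          · simp
        refine (add_le_add_left ((mul_le_of_le_one_right' (by split_ifs <;> simp)).trans
          (prob_findsol_none_le h0 h1 (below F y) (not_le.mp hle))) _).trans ?_
        rw [← htdef, ← ENNReal.ofReal_add (by positivity) (mul_nonneg (by positivity)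
          (Finset.sum_nonneg fun i _ => by split_ifs <;> linarith))]
        refine ENNReal.ofReal_le_ofReal ?_
        rw [if_neg hle, one_div, ← mul_add, inv_mul_le_iff₀ ht']
        linarith

theorem minfind_eq (ε : ℝ) (F : D → Timed ℤ) :
    minfind ε F = randomElement D >>= fun y => minfindLoop ε F (Fintype.card D) y := rfl

theorem expect_minfind_failure_le {ε : ℝ} (h0 : 0 < ε) (h1 : ε ≤ 1 / 2) (F : D → Timed ℤ) :
    expect (minfind ε F) (fun z => if ∀ x, (F z).val ≤ (F x).val then 0 else 1) ≤
      ENNReal.ofReal ε := by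
  rw [minfind_eq, expect_bind]
  refine expect_le_const _ fun y => (expect_minfindLoop_failure_le h0 h1 F _ y ?_).trans
    (ENNReal.ofReal_le_ofReal (by split_ifs <;> linarith))
  rw [solCount_below]
  refine Finset.card_lt_univ_of_notMem (x := y) ?_
  simp

/-! ## The expected running time of *minfind* -/

/-- The expected total time of the remaining rounds, up to a factor, when there are `t` elements
with smaller values. -/
noncomputable def timePotential (t : ℕ) : ℝ := if t = 0 then 1 else 3 - 1 / Real.sqrt t

theorem one_div_sqrt_le_one {t : ℕ} (ht : t ≠ 0) : 1 / Real.sqrt t ≤ 1 := by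
  have : (1 : ℝ) ≤ t := by exact_mod_cast Nat.one_le_iff_ne_zero.mpr ht
  rw [div_le_one (by positivity), Real.one_le_sqrt]
  exact this

theorem timePotential_le (t : ℕ) : timePotential t ≤ 3 := by
  unfold timePotential
  split_ifs
  · norm_num
  · linarith [show 0 ≤ 1 / Real.sqrt t by positivity]

theorem timePotential_pos (t : ℕ) : 0 < timePotential t := by
  unfold timePotential
  split_ifs with h
  · norm_num
  · linarith [one_div_sqrt_le_one h]

theorem timePotential_monotone : Monotone timePotential := by
  intro i j hij
  unfold timePotential
  split_ifs with hi hj hj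
  · exact le_rfl
  · linarith [one_div_sqrt_le_one hj]
  · omega
  · have : (0 : ℝ) < i := by exact_mod_cast Nat.pos_of_ne_zero hi
    gcongr

/-- Since `1/√i ≥ 2 (√(i+1) - √i)`. The value `1` at rank `0` makes `t = 1` an equality. -/
theorem sum_timePotential_le {t : ℕ} (ht : 1 ≤ t) :
    ∑ i ∈ Finset.range t, timePotential i ≤ 3 * t - 2 * Real.sqrt t := by
  induction t, ht using Nat.le_induction with
  | base => simp [timePotential]; norm_num
  | succ t ht ih =>
    have ht' : (0 : ℝ) < t := by exact_mod_cast ht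
    rw [Finset.sum_range_succ, timePotential, if_neg (by omega)]
    push_cast
    have hp : 0 < Real.sqrt t := Real.sqrt_pos.mpr ht'
    have hs := Real.sq_sqrt ht'.le
    have hs1 := Real.sq_sqrt (show (0 : ℝ) ≤ t + 1 by linarith)
    have key : 2 * (Real.sqrt ((t : ℝ) + 1) - Real.sqrt t) ≤ 1 / Real.sqrt t := by
      rw [le_div_iff₀ hp]
      nlinarith [sq_nonneg (Real.sqrt ((t : ℝ) + 1) - Real.sqrt t)]
    linarith

/-- With `K` the factor before the potential, a round costs at most `K/√t`, and the mean potential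
afterwards is at most `3 - 2/√t`; together they give `3 - 1/√t`. At `t = 0` the final, unsuccessful
search costs at most `K`. The factor `77` is `76` for *findsol* and `1` for evaluating `F y`. -/
theorem expectedTime_minfindLoop_le {ε : ℝ} (h0 : 0 < ε) (h1 : ε ≤ 1 / 2) (F : D → Timed ℤ)
    (k : ℕ) (y : D) :
    expectedTime (minfindLoop ε F k y) ≤
      ENNReal.ofReal (77 * Real.sqrt (Fintype.card D * logInv ε) * minfindUnit F *
        timePotential (solCount (below F y))) := by
  induction k generalizing y with
  | zero => exact (expectedTime_pure y).le.trans zero_le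
  | succ k ih =>
    set K := 77 * Real.sqrt (Fintype.card D * logInv ε) * minfindUnit F with hK
    have hK0 : 0 ≤ K := by positivity
    rw [expectedTime_minfindLoop_succ]
    have hsum := sum_prob_findsol_mul_le ε F y (h := fun i => K * timePotential i)
      (fun i j hij => mul_le_mul_of_nonneg_left (timePotential_monotone hij) hK0)
      (fun i => mul_nonneg hK0 (timePotential_pos i).le) _ (fun z _ => ih z)
    rw [← Finset.mul_sum] at hsum
    have hunit : (searchUnit (below F y) : ℝ) ≤ minfindUnit F := by
      exact_mod_cast searchUnit_below_le F y
    have hF : ((F y).time : ℝ≥0∞) ≤ ENNReal.ofReal (minfindUnit F) := by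
      rw [ENNReal.ofReal_natCast]
      have := time_le_worstTime F y
      exact_mod_cast show (F y).time ≤ minfindUnit F by unfold minfindUnit; omega
    have hlog : (1 : ℝ) ≤ logInv ε := by exact_mod_cast logInv_pos h0 h1
    have hN : (1 : ℝ) ≤ Fintype.card D := by exact_mod_cast Nat.succ_le_of_lt Fintype.card_pos
    set A := Real.sqrt (Fintype.card D * logInv ε) with hA
    have hAN : Real.sqrt (Fintype.card D) ≤ A :=
      Real.sqrt_le_sqrt (le_mul_of_one_le_right (by linarith) hlog)
    have hA1 : 1 ≤ A := by
      rw [hA, Real.one_le_sqrt]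
      nlinarith
    have hM : (0 : ℝ) ≤ minfindUnit F := by positivity
    rcases Nat.eq_zero_or_pos (solCount (below F y)) with ht | ht
    · rw [ht] at hsum ⊢
      rw [Finset.sum_range_zero, mul_zero, mul_zero, ENNReal.ofReal_zero, nonpos_iff_eq_zero]
        at hsum
      rw [hsum, add_zero]
      refine (add_le_add hF (expectedTime_findsol_le h0 h1 _)).trans ?_
      rw [← ENNReal.ofReal_add (by positivity) (by positivity)]
      refine ENNReal.ofReal_le_ofReal ?_
      rw [timePotential, if_pos rfl, mul_one, hK]
      have hc1 : 76 * A * searchUnit (below F y) ≤ 76 * A * minfindUnit F := by gcongr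
      have hc2 : (minfindUnit F : ℝ) ≤ A * minfindUnit F := le_mul_of_one_le_left hM hA1
      linarith
    · set t := solCount (below F y) with htdef
      have ht' : (0 : ℝ) < t := by exact_mod_cast ht
      have hst : 0 < Real.sqrt t := Real.sqrt_pos.mpr ht'
      -- This makes the single evaluation of `F y` no dearer than `A/√t` units.
      have htN : Real.sqrt t ≤ A :=
        le_trans (Real.sqrt_le_sqrt (by exact_mod_cast solCount_le_card (below F y))) hAN
      refine (add_le_add hF
        (add_le_add (expectedTime_findsol_le_of_solution h0 h1 _ ht) hsum)).trans ?_
      have hpsum : 0 ≤ ∑ i ∈ Finset.range t, timePotential i :=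
        Finset.sum_nonneg fun i _ => (timePotential_pos i).le
      rw [← ENNReal.ofReal_add (by positivity) (by positivity),
        ← ENNReal.ofReal_add (by positivity) (by positivity)]
      refine ENNReal.ofReal_le_ofReal ?_
      have hc1 : 76 * A / Real.sqrt t * searchUnit (below F y) ≤
          76 * A / Real.sqrt t * minfindUnit F := by gcongr
      have hc2 : (minfindUnit F : ℝ) ≤ A / Real.sqrt t * minfindUnit F :=
        le_mul_of_one_le_left hM ((one_le_div hst).mpr htN)
      have hc3 : (t : ℝ)⁻¹ * (K * ∑ i ∈ Finset.range t, timePotential i) ≤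
          (t : ℝ)⁻¹ * (K * (3 * t - 2 * Real.sqrt t)) := by
        gcongr
        exact sum_timePotential_le ht
      have hc4 : (t : ℝ)⁻¹ * (K * (3 * t - 2 * Real.sqrt t)) =
          K * (3 - 2 * (1 / Real.sqrt t)) := by
        have h2 : Real.sqrt t / t = 1 / Real.sqrt t := by
          rw [div_eq_div_iff ht'.ne' hst.ne', Real.mul_self_sqrt ht'.le, one_mul]
        rw [← h2]
        field_simp
      rw [timePotential, if_neg (by omega)]
      have hc5 : 76 * A / Real.sqrt t * minfindUnit F + A / Real.sqrt t * minfindUnit F =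
          K * (1 / Real.sqrt t) := by
        rw [hK]; ring
      linarith

theorem expectedTime_minfind_le {ε : ℝ} (h0 : 0 < ε) (h1 : ε ≤ 1 / 2) (F : D → Timed ℤ) :
    expectedTime (minfind ε F) ≤
      ENNReal.ofReal (232 * Real.sqrt (Fintype.card D * logInv ε) * minfindUnit F) := by
  rw [minfind_eq, expectedTime_bind]
  have hlog : (1 : ℝ) ≤ logInv ε := by exact_mod_cast logInv_pos h0 h1
  have hN : (1 : ℝ) ≤ Fintype.card D := by exact_mod_cast Nat.succ_le_of_lt Fintype.card_pos
  have hA1 : 1 ≤ Real.sqrt (Fintype.card D * logInv ε) := by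
    rw [Real.one_le_sqrt]
    nlinarith
  have hR : expectedTime (randomElement D) ≤ ENNReal.ofReal (minfindUnit F) := by
    refine (expectedTime_map_pmf _ _ _).le.trans ?_
    rw [ENNReal.ofReal_natCast]
    exact_mod_cast show registerCost D ≤ minfindUnit F by unfold minfindUnit; omega
  -- `232 = 77 · 3 + 1`: the potential is at most `3`, and the choice of the first element takes at
  -- most one unit.
  refine (add_le_add hR (expect_le_const _
    (r := ENNReal.ofReal (231 * Real.sqrt (Fintype.card D * logInv ε) * minfindUnit F))
    fun y => (expectedTime_minfindLoop_le h0 h1 F _ y).trans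
      (ENNReal.ofReal_le_ofReal ?_))).trans ?_
  · calc _ ≤ 77 * Real.sqrt (Fintype.card D * logInv ε) * minfindUnit F * 3 := by
          gcongr
          exact timePotential_le _
      _ = _ := by ring
  · rw [← ENNReal.ofReal_add (by positivity) (by positivity)]
    refine ENNReal.ofReal_le_ofReal ?_
    have : (minfindUnit F : ℝ) ≤ Real.sqrt (Fintype.card D * logInv ε) * minfindUnit F :=
      le_mul_of_one_le_left (by positivity) hA1
    linarith

end Minfind

/-! ## Deterministic computations -/

theorem Timed.bind_val {α β : Type} (c : Timed α) (f : α → Timed β) :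
    (c >>= f).val = (f c.val).val := rfl

theorem Timed.bind_time {α β : Type} (c : Timed α) (f : α → Timed β) :
    (c >>= f).time = c.time + (f c.val).time := rfl

theorem Timed.pure_val {α : Type} (a : α) : (pure a : Timed α).val = a := rfl

theorem tick_time (k : ℕ) : (tick k).time = k := rfl

theorem Timed.foldlM_val {α σ : Type} (f : σ → α → Timed σ) (l : List α) (s : σ) :
    (l.foldlM f s).val = l.foldl (fun s a => (f s a).val) s := by
  induction l generalizing s with
  | nil => rfl
  | cons a l ih => rw [List.foldlM_cons, Timed.bind_val, ih, List.foldl_cons]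

theorem Timed.foldlM_time_le {α σ : Type} (f : σ → α → Timed σ) (l : List α) (s : σ) (c : ℕ)
    (h : ∀ s, ∀ a ∈ l, (f s a).time ≤ c) : (l.foldlM f s).time ≤ l.length * c := by
  induction l generalizing s with
  | nil => exact Nat.zero_le _
  | cons a l ih =>
    rw [List.foldlM_cons, Timed.bind_time, List.length_cons, add_mul, one_mul, add_comm]
    exact add_le_add (ih _ fun s b hb => h s b (List.mem_cons_of_mem a hb))
      (h s a List.mem_cons_self)

/-! ## Euclid's algorithm and normalization -/

theorem euclid_val (a b : ℕ) : (euclid a b).val = Nat.gcd a b := by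
  induction b using Nat.strong_induction_on generalizing a with
  | _ b ih =>
    rw [euclid]
    split_ifs with h
    · simp [h, Timed.bind_val, Timed.pure_val]
    · rw [Timed.bind_val, ih _ (Nat.mod_lt _ (Nat.pos_of_ne_zero h)), Nat.gcd_comm a b,
        Nat.gcd_rec b a, Nat.gcd_comm]

/-- Two division steps, of cost `2` each, replace `b` by `b mod (a mod b) < b/2`, which has at least
one binary digit fewer. -/
theorem euclid_time_le (a b : ℕ) : (euclid a b).time ≤ 4 * Nat.size b + 1 := by
  induction b using Nat.strong_induction_on generalizing a with
  | _ b ih =>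
    rw [euclid]
    split_ifs with h
    · exact Nat.le_add_left _ _
    · have hb : 0 < b := Nat.pos_of_ne_zero h
      have hsb : 0 < Nat.size b := Nat.size_pos.mpr hb
      change 2 + (euclid b (a % b)).time ≤ _
      rw [euclid]
      split_ifs with h'
      · change 2 + (1 + 0) ≤ _
        omega
      · have hr : a % b < b := Nat.mod_lt _ hb
        have hr0 : 0 < a % b := Nat.pos_of_ne_zero h'
        change 2 + (2 + (euclid (a % b) (b % (a % b))).time) ≤ _
        have hlt : b % (a % b) < a % b := Nat.mod_lt _ hr0
        have hhalf : 2 * (b % (a % b)) < b := by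
          have h1 := Nat.div_add_mod b (a % b)
          have h2 : 1 ≤ b / (a % b) := (Nat.one_le_div_iff hr0).mpr hr.le
          have h3 := Nat.mul_le_mul_left (a % b) h2
          omega
        have hsize : Nat.size (b % (a % b)) + 1 ≤ Nat.size b := by
          have hb2 := Nat.lt_size_self b
          have : Nat.size (b % (a % b)) ≤ Nat.size b - 1 := by
            rw [Nat.size_le]
            obtain ⟨m, hm⟩ := Nat.exists_eq_succ_of_ne_zero hsb.ne'
            rw [hm, pow_succ] at hb2
            rw [hm, Nat.succ_sub_one]
            omega
          omega
        have := ih _ (hlt.trans hr) (a % b)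
        omega

section Normalize

variable {n : ℕ}

theorem foldl_gcd_dvd_iff (a : Fin n → ℤ) (l : List (Fin n)) (g d : ℕ) :
    d ∣ l.foldl (fun g k => Nat.gcd g (a k).natAbs) g ↔ d ∣ g ∧ ∀ k ∈ l, d ∣ (a k).natAbs := by
  induction l generalizing g with
  | nil => simp
  | cons k l ih => simp [ih, Nat.dvd_gcd_iff, and_assoc]

theorem gcdComponents_val (a : Fin n → ℤ) :
    (gcdComponents a).val = Finset.univ.gcd fun k => (a k).natAbs := by
  rw [gcdComponents, Timed.foldlM_val]
  simp only [Timed.bind_val, euclid_val]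
  refine Nat.dvd_antisymm ?_ ?_
  · refine Finset.dvd_gcd fun k _ => ?_
    exact ((foldl_gcd_dvd_iff a _ 0 _).mp dvd_rfl).2 k (List.mem_finRange k)
  · rw [foldl_gcd_dvd_iff]
    exact ⟨dvd_zero _, fun k _ => Finset.gcd_dvd (Finset.mem_univ k)⟩

theorem leadingSign_val (a : Fin n → ℤ) :
    (leadingSign a).val = (List.finRange n).foldl (fun s k => if s = 0 then (a k).sign else s) 0 := by
  rw [leadingSign, Timed.foldlM_val]
  rfl

theorem foldl_sign_mul (a b : Fin n → ℤ) {σ : ℤ} (hσ : σ ≠ 0)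
    (h : ∀ k, (b k).sign = σ * (a k).sign) (l : List (Fin n)) (s : ℤ) :
    l.foldl (fun s k => if s = 0 then (b k).sign else s) (σ * s) =
      σ * l.foldl (fun s k => if s = 0 then (a k).sign else s) s := by
  induction l generalizing s with
  | nil => rfl
  | cons k l ih =>
    rw [List.foldl_cons, List.foldl_cons, ← ih]
    congr 1
    by_cases hs : s = 0 <;> simp [hs, hσ, h]

theorem foldl_sign_eq_zero_iff (a : Fin n → ℤ) (l : List (Fin n)) (s : ℤ) :
    l.foldl (fun s k => if s = 0 then (a k).sign else s) s = 0 ↔ s = 0 ∧ ∀ k ∈ l, a k = 0 := by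
  induction l generalizing s with
  | nil => simp
  | cons k l ih =>
    rw [List.foldl_cons, ih]
    by_cases hs : s = 0 <;> simp [hs, Int.sign_eq_zero_iff_zero]

theorem sign_foldl_sign (a : Fin n → ℤ) (l : List (Fin n)) (s : ℤ) (hs : s.sign = s) :
    (l.foldl (fun s k => if s = 0 then (a k).sign else s) s).sign =
      l.foldl (fun s k => if s = 0 then (a k).sign else s) s := by
  induction l generalizing s with
  | nil => exact hs
  | cons k l ih =>
    rw [List.foldl_cons]
    refine ih _ ?_
    split_ifs
    · exact Int.sign_sign
    · exact hs

theorem leadingSign_eq_zero_iff (a : Fin n → ℤ) : (leadingSign a).val = 0 ↔ a = 0 := by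
  rw [leadingSign_val, foldl_sign_eq_zero_iff]
  simp [funext_iff]

theorem natAbs_leadingSign_le (a : Fin n → ℤ) : (leadingSign a).val.natAbs ≤ 1 := by
  rw [leadingSign_val, ← sign_foldl_sign a _ 0 Int.sign_zero]
  rw [Int.natAbs_sign]
  split_ifs <;> omega

theorem leadingSign_mul_self {a : Fin n → ℤ} (ha : a ≠ 0) :
    (leadingSign a).val * (leadingSign a).val = 1 := by
  have h0 := (leadingSign_eq_zero_iff a).not.mpr ha
  have h1 := natAbs_leadingSign_le a
  have : (leadingSign a).val = 1 ∨ (leadingSign a).val = -1 := by omega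
  rcases this with h | h <;> rw [h] <;> norm_num

theorem leadingSign_mul {a b : Fin n → ℤ} {σ : ℤ} (hσ : σ ≠ 0)
    (h : ∀ k, (b k).sign = σ * (a k).sign) : (leadingSign b).val = σ * (leadingSign a).val := by
  rw [leadingSign_val, leadingSign_val, ← foldl_sign_mul a b hσ h, mul_zero]

theorem normalizeVec_val (a : Fin n → ℤ) (k : Fin n) :
    (normalizeVec a).val k = (leadingSign a).val * (a k / ((gcdComponents a).val : ℤ)) := rfl

theorem gcdComponents_dvd (a : Fin n → ℤ) (k : Fin n) : ((gcdComponents a).val : ℤ) ∣ a k := by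
  rw [Int.natCast_dvd, gcdComponents_val]
  exact Finset.gcd_dvd (Finset.mem_univ k)

theorem gcdComponents_ne_zero {a : Fin n → ℤ} (ha : a ≠ 0) : (gcdComponents a).val ≠ 0 := by
  intro h
  refine ha (funext fun k => ?_)
  have := gcdComponents_dvd a k
  rwa [h, Nat.cast_zero, zero_dvd_iff] at this

theorem eq_mul_normalizeVec {a : Fin n → ℤ} (ha : a ≠ 0) (k : Fin n) :
    a k = ((leadingSign a).val * (gcdComponents a).val) * (normalizeVec a).val k := by
  have h := Int.mul_ediv_cancel' (gcdComponents_dvd a k)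
  rw [normalizeVec_val]
  calc a k = (gcdComponents a).val * (a k / (gcdComponents a).val) := h.symm
    _ = ((leadingSign a).val * (leadingSign a).val) *
        ((gcdComponents a).val * (a k / (gcdComponents a).val)) := by
        rw [leadingSign_mul_self ha, one_mul]
    _ = _ := by ring

theorem natAbs_normalizeVec_le (a : Fin n → ℤ) (k : Fin n) :
    ((normalizeVec a).val k).natAbs ≤ (a k).natAbs := by
  rw [normalizeVec_val, Int.natAbs_mul]
  refine (Nat.mul_le_mul (natAbs_leadingSign_le a) (Int.natAbs_ediv_le_natAbs _ _)).trans ?_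
  rw [one_mul]

/-- A factor `r` multiplies the gcd by `|r|` and the leading sign by the sign `σ` of `r`; in the
normalized vector only `σ² = 1` remains. The factor is real because the lines are. -/
theorem normalizeVec_eq_of_parallel {a b : Fin n → ℤ} {r : ℝ} (ha : a ≠ 0) (hr : r ≠ 0)
    (h : ∀ k, (b k : ℝ) = r * a k) : (normalizeVec a).val = (normalizeVec b).val := by
  obtain ⟨j, hj⟩ := Function.ne_iff.mp ha
  have hj' : (a j : ℝ) ≠ 0 := by exact_mod_cast hj
  obtain ⟨σ, hσ1, hσr⟩ : ∃ σ : ℤ, σ * σ = 1 ∧ (σ : ℝ) * |r| = r := by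
    rcases hr.lt_or_gt with hr | hr
    · exact ⟨-1, by norm_num, by rw [abs_of_neg hr]; push_cast; ring⟩
    · exact ⟨1, by norm_num, by rw [abs_of_pos hr]; push_cast; ring⟩
  have hσ : σ ≠ 0 := by rintro rfl; simp at hσ1
  have hsign : ∀ k, (b k).sign = σ * (a k).sign := by
    intro k
    have hσ' : σ = 1 ∨ σ = -1 := mul_self_eq_one_iff.mp hσ1
    have hpos : 0 < |r| := abs_pos.mpr hr
    have hk := h k
    rw [← hσr] at hk
    rcases hσ' with rfl | rfl
    · push_cast at hk
      rcases lt_trichotomy (a k) 0 with h0 | h0 | h0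
      · have : (b k : ℝ) < 0 := by
          rw [hk, one_mul]; exact mul_neg_of_pos_of_neg hpos (by exact_mod_cast h0)
        rw [Int.sign_eq_neg_one_of_neg h0, Int.sign_eq_neg_one_of_neg (by exact_mod_cast this)]
        norm_num
      · have : (b k : ℝ) = 0 := by rw [hk, h0]; simp
        rw [h0, show b k = 0 by exact_mod_cast this]
        simp
      · have : 0 < (b k : ℝ) := by
          rw [hk, one_mul]; exact mul_pos hpos (by exact_mod_cast h0)
        rw [Int.sign_eq_one_of_pos h0, Int.sign_eq_one_of_pos (by exact_mod_cast this)]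
        norm_num
    · push_cast at hk
      rcases lt_trichotomy (a k) 0 with h0 | h0 | h0
      · have : 0 < (b k : ℝ) := by
          have h2 : |r| * (a k : ℝ) < 0 := mul_neg_of_pos_of_neg hpos (by exact_mod_cast h0)
          rw [hk]; linarith
        rw [Int.sign_eq_neg_one_of_neg h0, Int.sign_eq_one_of_pos (by exact_mod_cast this)]
        norm_num
      · have : (b k : ℝ) = 0 := by rw [hk, h0]; simp
        rw [h0, show b k = 0 by exact_mod_cast this]
        simp
      · have : (b k : ℝ) < 0 := by
          have h2 : 0 < |r| * (a k : ℝ) := mul_pos hpos (by exact_mod_cast h0)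
          rw [hk]; linarith
        rw [Int.sign_eq_one_of_pos h0, Int.sign_eq_neg_one_of_neg (by exact_mod_cast this)]
        norm_num
  -- A real factor cannot be taken out of an integer gcd, so the proportion is written with
  -- integers: `b j * a k = a j * b k`.
  have hgcd : (b j).natAbs * (gcdComponents a).val = (a j).natAbs * (gcdComponents b).val := by
    have h1 : ∀ c : ℕ, ∀ v : Fin n → ℤ, c * (gcdComponents v).val =
        Finset.univ.gcd fun k => c * (v k).natAbs := by
      intro c v
      rw [gcdComponents_val, Finset.gcd_mul_left, normalize_eq]
    rw [h1, h1]
    refine Finset.gcd_congr rfl fun k _ => ?_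
    rw [← Int.natAbs_mul, ← Int.natAbs_mul]
    congr 1
    have : (b j : ℝ) * a k = a j * b k := by rw [h j, h k]; ring
    exact_mod_cast this
  have hg : |r| * (gcdComponents a).val = (gcdComponents b).val := by
    have h2 : ((b j).natAbs : ℝ) * (gcdComponents a).val =
        (a j).natAbs * (gcdComponents b).val := by exact_mod_cast hgcd
    rw [Nat.cast_natAbs, Nat.cast_natAbs, Int.cast_abs, Int.cast_abs, h j, abs_mul] at h2
    have h3 : |(a j : ℝ)| ≠ 0 := abs_ne_zero.mpr hj'
    refine mul_left_cancel₀ h3 ?_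
    rw [← h2]
    ring
  have hb : b ≠ 0 := by
    refine Function.ne_iff.mpr ⟨j, fun h0 => ?_⟩
    have := h j
    rw [h0] at this
    simp [hr, hj'] at this
  funext k
  rw [normalizeVec_val, normalizeVec_val, leadingSign_mul hσ hsign]
  have hq : b k / ((gcdComponents b).val : ℤ) = σ * (a k / ((gcdComponents a).val : ℤ)) := by
    refine Int.ediv_eq_of_eq_mul_right (by exact_mod_cast gcdComponents_ne_zero hb) ?_
    obtain ⟨c, hc⟩ := gcdComponents_dvd a k
    rw [hc, Int.mul_ediv_cancel_left _ (by exact_mod_cast gcdComponents_ne_zero ha)]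
    have : (b k : ℝ) = (gcdComponents b).val * (σ * c) := by
      rw [h k, hc, ← hg]
      push_cast
      calc r * ((gcdComponents a).val * (c : ℝ))
          = (σ * |r|) * ((gcdComponents a).val * (c : ℝ)) := by rw [hσr]
        _ = _ := by ring
    exact_mod_cast this
  rw [hq]
  calc (leadingSign a).val * (a k / ((gcdComponents a).val : ℤ))
      = (σ * σ) * ((leadingSign a).val * (a k / ((gcdComponents a).val : ℤ))) := by
        rw [hσ1, one_mul]
    _ = _ := by ring

theorem normalizeVec_time_le (a : Fin n → ℤ) {L : ℕ} (h : ∀ k, Nat.size (a k).natAbs ≤ L) :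
    (normalizeVec a).time ≤ n * (4 * L + 6) := by
  have h1 : (gcdComponents a).time ≤ n * (4 * L + 2) := by
    refine (Timed.foldlM_time_le _ _ _ (4 * L + 2) fun g k _ => ?_).trans_eq
      (by rw [List.length_finRange])
    rw [Timed.bind_time, tick_time]
    have := euclid_time_le g (a k).natAbs
    have := h k
    omega
  have h2 : (leadingSign a).time ≤ n * 2 :=
    (Timed.foldlM_time_le _ _ _ 2 fun s k _ => le_rfl).trans_eq (by rw [List.length_finRange])
  have h3 : (normalizeVec a).time =
      (gcdComponents a).time + ((leadingSign a).time + (2 * n + 0)) := rfl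
  rw [h3]
  calc _ ≤ n * (4 * L + 2) + (n * 2 + (2 * n + 0)) := by gcongr
    _ = _ := by ring

end Normalize

/-! ## The table of directions -/

namespace Table

variable {n : ℕ}

/-- The content of the cell with the given address. -/
def lookup : Table n → List (Option Bool) → Option ((Fin n → ℤ) × ℕ)
  | H, [] => H.entry
  | H, s :: w => lookup (H.next s) w

/-- The number of cells. -/
def cells : Table n → ℕ
  | empty => 0
  | node _ c => 1 + (cells (c none) + cells (c (some false)) + cells (c (some true)))

theorem lookup_empty (w : List (Option Bool)) : lookup (empty : Table n) w = none := by
  induction w with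
  | nil => rfl
  | cons s w ih => exact ih

theorem incrementAt_cons_val (v : Fin n → ℤ) (H : Table n) (s : Option Bool)
    (w : List (Option Bool)) :
    (incrementAt v H (s :: w)).val =
      node H.entry (Function.update H.next s (incrementAt v (H.next s) w).val) := by
  rw [incrementAt]
  rfl

theorem incrementAt_cons_time (v : Fin n → ℤ) (H : Table n) (s : Option Bool)
    (w : List (Option Bool)) :
    (incrementAt v H (s :: w)).time = 1 + (incrementAt v (H.next s) w).time := by
  rw [incrementAt]
  rfl

theorem incrementAt_nil_val (v : Fin n → ℤ) (H : Table n) :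
    (incrementAt v H []).val =
      node (some (H.entry.elim (v, 1) fun e => (e.1, e.2 + 1))) H.next := by
  rw [incrementAt, Timed.bind_val]
  cases H.entry <;> rfl

theorem incrementAt_time (v : Fin n → ℤ) (H : Table n) (w : List (Option Bool)) :
    (incrementAt v H w).time = w.length + 2 := by
  induction w generalizing H with
  | nil =>
    rw [incrementAt, Timed.bind_time, tick_time]
    cases H.entry <;> rfl
  | cons s w ih =>
    rw [incrementAt_cons_time, ih, List.length_cons]
    ring

theorem lookup_incrementAt (v : Fin n → ℤ) (H : Table n) (w w' : List (Option Bool)) :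
    lookup (incrementAt v H w).val w' = if w' = w then
      some ((lookup H w).elim (v, 1) fun e => (e.1, e.2 + 1)) else lookup H w' := by
  induction w generalizing H w' with
  | nil =>
    rw [incrementAt_nil_val]
    cases w' <;> simp [lookup, entry, next]
  | cons s w ih =>
    rw [incrementAt_cons_val]
    cases w' with
    | nil => simp [lookup, entry]
    | cons s' w' =>
      by_cases hs : s' = s
      · subst hs
        simp [lookup, next, ih]
      · simp [lookup, next, hs]

theorem cells_entry_next (H : Table n) (e : Option ((Fin n → ℤ) × ℕ)) :
    cells (node e H.next) ≤ cells H + 1 := by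
  cases H with
  | empty => simp [cells, next]
  | node e' c => simp [cells, next]

theorem cells_incrementAt_le (v : Fin n → ℤ) (H : Table n) (w : List (Option Bool)) :
    cells (incrementAt v H w).val ≤ cells H + (w.length + 1) := by
  induction w generalizing H with
  | nil =>
    rw [incrementAt_nil_val]
    exact cells_entry_next H _
  | cons s w ih =>
    rw [incrementAt_cons_val, List.length_cons]
    have h := ih (H.next s)
    have h' := cells_entry_next H H.entry
    rcases s with _ | _ | _ <;> simp [cells] at * <;> omega

theorem findMax_empty : (findMax (empty : Table n)).val = none := rfl

theorem findMax_node_val (e : Option ((Fin n → ℤ) × ℕ)) (c : Option Bool → Table n) :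
    (findMax (node e c)).val = larger e (larger (findMax (c none)).val
      (larger (findMax (c (some false))).val (findMax (c (some true))).val)) := rfl

/-- Each cell costs `4`, plus one step for each of up to three empty subtables; the final `1` is for
an empty root. -/
theorem findMax_time_le (H : Table n) : (findMax H).time ≤ 7 * cells H + 1 := by
  induction H with
  | empty => exact le_rfl
  | node e c ih =>
    have h : (findMax (node e c)).time = (findMax (c none)).time +
      ((findMax (c (some false))).time + ((findMax (c (some true))).time + (4 + 0))) := rfl
    have h1 := ih none
    have h2 := ih (some false)
    have h3 := ih (some true)
    rw [h, cells]
    omega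

theorem larger_eq_some {a b : Option ((Fin n → ℤ) × ℕ)} {e : (Fin n → ℤ) × ℕ}
    (h : larger a b = some e) : a = some e ∨ b = some e := by
  rcases a with _ | a <;> rcases b with _ | b <;> simp only [larger] at h
  · exact Or.inr h
  · exact Or.inr h
  · exact Or.inl h
  · split_ifs at h
    · exact Or.inr h
    · exact Or.inl h

theorem exists_larger {a b : Option ((Fin n → ℤ) × ℕ)} {m : ℕ}
    (h : (∃ e, a = some e ∧ m ≤ e.2) ∨ ∃ e, b = some e ∧ m ≤ e.2) :
    ∃ e, larger a b = some e ∧ m ≤ e.2 := by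
  rcases h with ⟨e, rfl, he⟩ | ⟨e, rfl, he⟩
  · rcases b with _ | b
    · exact ⟨e, rfl, he⟩
    · simp only [larger]
      split_ifs with h
      · exact ⟨b, rfl, by omega⟩
      · exact ⟨e, rfl, he⟩
  · rcases a with _ | a
    · exact ⟨e, rfl, he⟩
    · simp only [larger]
      split_ifs with h
      · exact ⟨e, rfl, he⟩
      · exact ⟨a, rfl, by omega⟩

theorem exists_lookup_of_findMax {H : Table n} {e : (Fin n → ℤ) × ℕ}
    (h : (findMax H).val = some e) : ∃ w, lookup H w = some e := by
  induction H with
  | empty => simp [findMax_empty] at h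
  | node e' c ih =>
    rw [findMax_node_val] at h
    rcases larger_eq_some h with h | h
    · exact ⟨[], h⟩
    rcases larger_eq_some h with h | h
    · obtain ⟨w, hw⟩ := ih _ h
      exact ⟨none :: w, hw⟩
    rcases larger_eq_some h with h | h
    · obtain ⟨w, hw⟩ := ih _ h
      exact ⟨some false :: w, hw⟩
    · obtain ⟨w, hw⟩ := ih _ h
      exact ⟨some true :: w, hw⟩

theorem exists_findMax_of_lookup {H : Table n} {w : List (Option Bool)} {e : (Fin n → ℤ) × ℕ}
    (h : lookup H w = some e) : ∃ e', (findMax H).val = some e' ∧ e.2 ≤ e'.2 := by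
  induction H generalizing w with
  | empty => simp [lookup_empty] at h
  | node e' c ih =>
    rw [findMax_node_val]
    rcases w with _ | ⟨_ | _ | _, w⟩
    · exact exists_larger (Or.inl ⟨e, h, le_rfl⟩)
    · exact exists_larger (Or.inr (exists_larger (Or.inl (ih none h))))
    · exact exists_larger (Or.inr (exists_larger (Or.inr (exists_larger
        (Or.inl (ih (some false) h))))))
    · exact exists_larger (Or.inr (exists_larger (Or.inr (exists_larger
        (Or.inr (ih (some true) h))))))

/-! ## Addresses -/

/-- The separator `none` is not a digit, so the code is prefix-free and concatenated addresses can
be decoded. -/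
theorem map_some_append_none_inj {l l' : List Bool} {r r' : List (Option Bool)}
    (h : l.map some ++ none :: r = l'.map some ++ none :: r') : l = l' ∧ r = r' := by
  induction l generalizing l' with
  | nil => cases l' <;> simp_all
  | cons b l ih =>
    cases l' with
    | nil => simp at h
    | cons b' l' =>
      simp only [List.map_cons, List.cons_append, List.cons.injEq, Option.some.injEq] at h
      obtain ⟨h1, h2⟩ := ih h.2
      exact ⟨by rw [h.1, h1], h2⟩

theorem bits_injective : Function.Injective Nat.bits := by
  intro a b h
  refine Nat.digits.injective 2 ?_
  rw [Nat.digits_two_eq_bits, Nat.digits_two_eq_bits, h]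

theorem addressInt_append_inj {z z' : ℤ} {r r' : List (Option Bool)}
    (h : addressInt z ++ r = addressInt z' ++ r') : z = z' ∧ r = r' := by
  simp only [addressInt, List.cons_append, List.append_assoc, List.nil_append, List.cons.injEq,
    Option.some.injEq, decide_eq_decide] at h
  obtain ⟨hs, hb⟩ := h
  obtain ⟨h1, h2⟩ := map_some_append_none_inj hb
  have h3 := bits_injective h1
  exact ⟨by omega, h2⟩

theorem flatMap_addressInt_inj {v v' : Fin n → ℤ} (l : List (Fin n))
    (h : (l.flatMap fun k => addressInt (v k)) = l.flatMap fun k => addressInt (v' k)) :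
    ∀ k ∈ l, v k = v' k := by
  induction l with
  | nil => simp
  | cons k l ih =>
    rw [List.flatMap_cons, List.flatMap_cons] at h
    obtain ⟨h1, h2⟩ := addressInt_append_inj h
    intro j hj
    rcases List.mem_cons.mp hj with rfl | hj
    · exact h1
    · exact ih h2 j hj

theorem address_val (v : Fin n → ℤ) :
    (address v).val = (List.finRange n).flatMap fun k => addressInt (v k) := rfl

theorem address_time (v : Fin n → ℤ) : (address v).time = (address v).val.length := rfl

theorem address_injective {v v' : Fin n → ℤ} (h : (address v).val = (address v').val) : v = v' :=
  funext fun k => flatMap_addressInt_inj _ h k (List.mem_finRange k)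

theorem length_address_le (v : Fin n → ℤ) {L : ℕ} (h : ∀ k, Nat.size (v k).natAbs ≤ L) :
    (address v).val.length ≤ n * (L + 2) := by
  rw [address_val, List.length_flatMap]
  refine (List.sum_le_card_nsmul _ (L + 2) ?_).trans_eq (by simp)
  intro x hx
  obtain ⟨k, -, rfl⟩ := List.mem_map.mp hx
  have := h k
  simp only [addressInt, List.length_cons, List.length_append, List.length_map,
    Nat.size_eq_bits_len, List.length_nil]
  omega

/-! ## The table as a multiset of keys -/

/-- The table holds exactly the keys `v` with `0 < κ v`, each with value `κ v`. -/
def Represents (H : Table n) (κ : (Fin n → ℤ) → ℕ) : Prop :=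
  ∀ w v c, lookup H w = some (v, c) ↔ w = (address v).val ∧ c = κ v ∧ 0 < c

theorem represents_empty : Represents (empty : Table n) fun _ => 0 := by
  intro w v c
  rw [lookup_empty]
  simp only [reduceCtorEq, false_iff]
  omega

theorem increment_val (H : Table n) (v : Fin n → ℤ) :
    (H.increment v).val = (incrementAt v H (address v).val).val := rfl

theorem increment_time (H : Table n) (v : Fin n → ℤ) :
    (H.increment v).time = 2 * (address v).val.length + 2 := by
  rw [increment, Timed.bind_time, address_time, incrementAt_time]
  ring

/-- Addresses are injective, so the cell reached holds nothing or the key `v` itself; collisions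
cannot occur. -/
theorem Represents.increment {H : Table n} {κ : (Fin n → ℤ) → ℕ} (h : Represents H κ)
    (v : Fin n → ℤ) : Represents (H.increment v).val fun u => κ u + if v = u then 1 else 0 := by
  intro w u c
  rw [increment_val, lookup_incrementAt]
  by_cases hw : w = (address v).val
  · rw [if_pos hw]
    have hlook : lookup H (address v).val = if 0 < κ v then some (v, κ v) else none := by
      split_ifs with hκ
      · exact (h _ _ _).mpr ⟨rfl, rfl, hκ⟩
      · rw [Option.eq_none_iff_forall_ne_some]
        rintro ⟨u, c⟩ hu
        obtain ⟨h1, h2, h3⟩ := (h _ _ _).mp hu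
        rw [address_injective h1] at hκ
        omega
    have hval : (lookup H (address v).val).elim (v, 1) (fun e => (e.1, e.2 + 1)) =
        (v, κ v + 1) := by
      rw [hlook]
      split_ifs with hκ
      · rfl
      · rw [show κ v = 0 by omega]
        rfl
    rw [hval, hw, Option.some.injEq, Prod.mk.injEq]
    constructor
    · rintro ⟨rfl, rfl⟩
      simp
    · rintro ⟨h1, h2, -⟩
      have := address_injective h1
      subst this
      simp only [if_true] at h2
      exact ⟨rfl, h2.symm⟩
  · rw [if_neg hw, h]
    by_cases hu : v = u
    · subst hu
      simp [hw]
    · simp [hu]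

end Table

/-! ## The function `mup` -/

section Mup

variable {N n : ℕ}

/-- The normalized vector from `p P` to `p i`. -/
def dir (p : Fin N → Fin n → ℤ) (P i : Fin N) : Fin n → ℤ :=
  (normalizeVec fun k => p i k - p P k).val

/-- The number of points in direction `v` from `p P`. -/
def dirCount (p : Fin N → Fin n → ℤ) (P : Fin N) (v : Fin n → ℤ) : ℕ :=
  (Finset.univ.filter fun i => i ≠ P ∧ dir p P i = v).card

/-- One step in the construction of the table of directions. -/
def directionStep (p : Fin N → Fin n → ℤ) (P : Fin N) (H : Table n) (i : Fin N) :
    Timed (Table n) := do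
  tick 1
  if i = P then return H
  else do
    tick (3 * n)
    let a ← normalizeVec (fun k => p i k - p P k)
    H.increment a

theorem directionTable_eq (p : Fin N → Fin n → ℤ) (P : Fin N) :
    directionTable p P = (List.finRange N).foldlM (directionStep p P) Table.empty := rfl

theorem directionStep_self (p : Fin N → Fin n → ℤ) (P : Fin N) (H : Table n) :
    directionStep p P H P = ⟨H, 1⟩ := by
  simp only [directionStep, if_true]
  rfl

theorem directionStep_of_ne (p : Fin N → Fin n → ℤ) {P i : Fin N} (h : i ≠ P) (H : Table n) :
    directionStep p P H i = ⟨(H.increment (dir p P i)).val,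
      1 + (3 * n + ((normalizeVec fun k => p i k - p P k).time +
        (H.increment (dir p P i)).time))⟩ := by
  simp only [directionStep, if_neg h]
  rfl

theorem represents_foldl_directionStep (p : Fin N → Fin n → ℤ) (P : Fin N) (l : List (Fin N))
    (H : Table n) (κ : (Fin n → ℤ) → ℕ) (h : H.Represents κ) :
    (l.foldl (fun H i => (directionStep p P H i).val) H).Represents
      fun v => κ v + l.countP fun i => i ≠ P ∧ dir p P i = v := by
  induction l generalizing H κ with
  | nil => exact h
  | cons i l ih =>
    rw [List.foldl_cons]
    by_cases hi : i = P
    · subst hi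
      rw [directionStep_self]
      simpa [List.countP_cons] using ih H κ h
    · rw [directionStep_of_ne p hi]
      have := ih _ _ (h.increment (dir p P i))
      simpa [List.countP_cons, hi, add_assoc, add_comm, add_left_comm] using this

theorem represents_directionTable (p : Fin N → Fin n → ℤ) (P : Fin N) :
    (directionTable p P).val.Represents (dirCount p P) := by
  have h := represents_foldl_directionStep p P (List.finRange N) _ _ Table.represents_empty
  rw [directionTable_eq, Timed.foldlM_val]
  convert h using 2 with v
  rw [zero_add, List.countP_eq_length_filter]
  rfl

theorem mup_val (p : Fin N → Fin n → ℤ) (P : Fin N) :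
    (mup p P).val = ((directionTable p P).val.findMax.val.map Prod.snd).getD 0 := rfl

theorem mupKey_val (p : Fin N → Fin n → ℤ) (P : Fin N) :
    (mupKey p P).val = ((directionTable p P).val.findMax.val.map Prod.fst).getD 0 := rfl

theorem dirCount_le_mup (p : Fin N → Fin n → ℤ) (P : Fin N) (v : Fin n → ℤ) :
    dirCount p P v ≤ (mup p P).val := by
  rcases Nat.eq_zero_or_pos (dirCount p P v) with h | h
  · rw [h]; exact Nat.zero_le _
  · obtain ⟨e, he, hle⟩ := Table.exists_findMax_of_lookup
      ((represents_directionTable p P _ v _).mpr ⟨rfl, rfl, h⟩)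
    rw [mup_val, he]
    exact hle

/-- The second point makes the table nonempty, so the default values in `mup` and `mupKey` are not
used. -/
theorem dirCount_mupKey (p : Fin N → Fin n → ℤ) {P Q : Fin N} (hQ : Q ≠ P) :
    dirCount p P (mupKey p P).val = (mup p P).val ∧ 0 < (mup p P).val := by
  have hpos : 0 < dirCount p P (dir p P Q) :=
    Finset.card_pos.mpr ⟨Q, by simp [hQ]⟩
  obtain ⟨⟨v, c⟩, he, hle⟩ := Table.exists_findMax_of_lookup
    ((represents_directionTable p P _ _ _).mpr ⟨rfl, rfl, hpos⟩)
  obtain ⟨w, hw⟩ := Table.exists_lookup_of_findMax he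
  obtain ⟨-, hc, hc0⟩ := (represents_directionTable p P _ _ _).mp hw
  rw [mup_val, mupKey_val, he]
  exact ⟨hc.symm, hc0⟩

/-! ## The running time of `mup` -/

theorem natAbs_sub_le_two_mul {p : Fin N → Fin n → ℤ} {U : ℕ} (hp : ∀ i k, |p i k| ≤ (U : ℤ))
    (P i : Fin N) (k : Fin n) : (p i k - p P k).natAbs ≤ 2 * U := by
  have h1 := abs_le.mp (hp i k)
  have h2 := abs_le.mp (hp P k)
  omega

theorem length_address_dir_le {p : Fin N → Fin n → ℤ} {U : ℕ} (hp : ∀ i k, |p i k| ≤ (U : ℤ))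
    (P i : Fin N) :
    (Table.address (dir p P i)).val.length ≤ n * (Nat.size (2 * U) + 2) :=
  Table.length_address_le _ fun k => Nat.size_le_size
    ((natAbs_normalizeVec_le _ k).trans (natAbs_sub_le_two_mul hp P i k))

theorem directionStep_time_le {p : Fin N → Fin n → ℤ} {U : ℕ} (hp : ∀ i k, |p i k| ≤ (U : ℤ))
    (P : Fin N) (H : Table n) (i : Fin N) :
    (directionStep p P H i).time ≤ n * (6 * Nat.size (2 * U) + 13) + 3 := by
  by_cases hi : i = P
  · subst hi
    rw [directionStep_self]
    exact le_trans (by norm_num) (Nat.le_add_left _ _)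
  · rw [directionStep_of_ne p hi, Table.increment_time]
    have h1 := length_address_dir_le hp P i
    have h2 := normalizeVec_time_le (fun k => p i k - p P k) (L := Nat.size (2 * U))
      fun k => Nat.size_le_size (natAbs_sub_le_two_mul hp P i k)
    change 1 + (3 * n + ((normalizeVec fun k => p i k - p P k).time +
      (2 * (Table.address (dir p P i)).val.length + 2))) ≤ _
    calc _ ≤ 1 + (3 * n + (n * (4 * Nat.size (2 * U) + 6) +
          (2 * (n * (Nat.size (2 * U) + 2)) + 2))) := by gcongr
      _ = _ := by ring

theorem directionTable_time_le {p : Fin N → Fin n → ℤ} {U : ℕ} (hp : ∀ i k, |p i k| ≤ (U : ℤ))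
    (P : Fin N) :
    (directionTable p P).time ≤ N * (n * (6 * Nat.size (2 * U) + 13) + 3) :=
  (Timed.foldlM_time_le _ _ _ _ fun H i _ => directionStep_time_le hp P H i).trans_eq
    (by rw [List.length_finRange])

theorem cells_foldl_directionStep_le {p : Fin N → Fin n → ℤ} {U : ℕ}
    (hp : ∀ i k, |p i k| ≤ (U : ℤ)) (P : Fin N) (l : List (Fin N)) (H : Table n) :
    (l.foldl (fun H i => (directionStep p P H i).val) H).cells ≤
      H.cells + l.length * (n * (Nat.size (2 * U) + 2) + 1) := by
  induction l generalizing H with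
  | nil => exact Nat.le_add_right _ _
  | cons i l ih =>
    rw [List.foldl_cons, List.length_cons, add_mul, one_mul]
    refine (ih _).trans ?_
    have h : (directionStep p P H i).val.cells ≤
        H.cells + (n * (Nat.size (2 * U) + 2) + 1) := by
      by_cases hi : i = P
      · subst hi
        rw [directionStep_self]
        exact Nat.le_add_right _ _
      · rw [directionStep_of_ne p hi]
        refine (Table.cells_incrementAt_le _ _ _).trans ?_
        gcongr
        exact length_address_dir_le hp P i
    omega

theorem findMax_directionTable_time_le {p : Fin N → Fin n → ℤ} {U : ℕ}
    (hp : ∀ i k, |p i k| ≤ (U : ℤ)) (P : Fin N) :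
    (directionTable p P).val.findMax.time ≤
      7 * (N * (n * (Nat.size (2 * U) + 2) + 1)) + 1 := by
  refine (Table.findMax_time_le _).trans ?_
  have h := cells_foldl_directionStep_le hp P (List.finRange N) Table.empty
  rw [List.length_finRange, Table.cells, zero_add] at h
  rw [directionTable_eq, Timed.foldlM_val]
  gcongr

theorem directionTable_findMax_time_le {p : Fin N → Fin n → ℤ} {U : ℕ}
    (hp : ∀ i k, |p i k| ≤ (U : ℤ)) (P : Fin N) (hN : 2 ≤ N) (hn : 1 ≤ n) (hU : 2 ≤ U) :
    (directionTable p P).time + (directionTable p P).val.findMax.time ≤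
      52 * (N * n * Nat.size (2 * U)) := by
  have hL : 1 ≤ Nat.size (2 * U) := Nat.size_pos.mpr (by omega)
  have h1 := directionTable_time_le hp P
  have h2 := findMax_directionTable_time_le hp P
  set L := Nat.size (2 * U)
  have hNn : N ≤ N * n := Nat.le_mul_of_pos_right N hn
  have hNnL : N * n ≤ N * n * L := Nat.le_mul_of_pos_right _ hL
  have e1 : N * (n * (6 * L + 13) + 3) = 6 * (N * n * L) + 13 * (N * n) + 3 * N := by ring
  have e2 : 7 * (N * (n * (L + 2) + 1)) + 1 = 7 * (N * n * L) + 14 * (N * n) + 7 * N + 1 := by ring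
  -- Up to `N n L`, the table costs `6 + 13 + 3` and the walk `7 + 14 + 7 + 1`.
  omega

theorem mup_time (p : Fin N → Fin n → ℤ) (P : Fin N) :
    (mup p P).time =
      (directionTable p P).time + ((directionTable p P).val.findMax.time + (1 + 0)) := rfl

theorem mupKey_time (p : Fin N → Fin n → ℤ) (P : Fin N) :
    (mupKey p P).time =
      (directionTable p P).time + ((directionTable p P).val.findMax.time + (n + 0)) := rfl

end Mup

/-! ## The best line -/

section Lines

variable {N n : ℕ}

theorem sub_ne_zero_of_injective {p : Fin N → Fin n → ℤ} (hp : Function.Injective p)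
    {P i : Fin N} (h : i ≠ P) : (fun k => p i k - p P k) ≠ 0 := by
  intro h0
  refine h (hp (funext fun k => ?_))
  have := congrFun h0 k
  simpa [sub_eq_zero] using this

theorem toReal_mem_lineOf {p : Fin N → Fin n → ℤ} (hp : Function.Injective p)
    {P i : Fin N} (h : i ≠ P) : toReal (p i) ∈ lineOf (p P) (dir p P i) := by
  rw [lineOf, AffineSubspace.mem_mk', Submodule.mem_span_singleton]
  set a : Fin n → ℤ := fun k => p i k - p P k with ha
  refine ⟨((leadingSign a).val * (gcdComponents a).val : ℤ), funext fun k => ?_⟩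
  have := eq_mul_normalizeVec (sub_ne_zero_of_injective hp h) k
  simp only [Pi.smul_apply, smul_eq_mul, vsub_eq_sub, Pi.sub_apply, toReal, dir]
  rw [← Int.cast_mul, ← this, Int.cast_sub]

/-- The additional point is `P` itself. -/
theorem pointsOn_lineOf_ge {p : Fin N → Fin n → ℤ} (hp : Function.Injective p) (P : Fin N)
    (v : Fin n → ℤ) : dirCount p P v + 1 ≤ pointsOn p (lineOf (p P) v) := by
  classical
  set s := Finset.univ.filter fun i => i ≠ P ∧ dir p P i = v with hs
  have hP : P ∉ s := by simp [hs]
  change s.card + 1 ≤ _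
  rw [← Finset.card_insert_of_notMem hP, ← Set.ncard_coe_finset]
  refine Set.ncard_le_ncard ?_ (Set.toFinite _)
  intro i hi
  rcases Finset.mem_insert.mp hi with rfl | hi
  · exact AffineSubspace.self_mem_mk' (toReal (p i)) (Submodule.span ℝ {toReal v})
  · obtain ⟨h1, h2⟩ := (Finset.mem_filter_univ i).mp hi
    exact h2 ▸ toReal_mem_lineOf hp h1

/-- The direction space is one-dimensional, so both difference vectors are parallel, and
normalization picks the same representative. -/
theorem dir_eq_of_mem_line {p : Fin N → Fin n → ℤ} (hp : Function.Injective p)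
    {L : AffineSubspace ℝ (Fin n → ℝ)} (hL : IsLine L) {Q i j : Fin N} (hQ : toReal (p Q) ∈ L)
    (hi : toReal (p i) ∈ L) (hj : toReal (p j) ∈ L) (hiQ : i ≠ Q) (hjQ : j ≠ Q) :
    dir p Q i = dir p Q j := by
  have hvi := AffineSubspace.vsub_mem_direction hi hQ
  have hvj := AffineSubspace.vsub_mem_direction hj hQ
  have hne : ∀ {l : Fin N}, l ≠ Q → toReal (p l) -ᵥ toReal (p Q) ≠ 0 := by
    intro l hl h0
    refine sub_ne_zero_of_injective hp hl (funext fun k => ?_)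
    have := congrFun h0 k
    simp only [vsub_eq_sub, Pi.sub_apply, toReal, Pi.zero_apply] at this
    exact_mod_cast this
  obtain ⟨r, hr⟩ := (finrank_eq_one_iff_of_nonzero' (⟨_, hvi⟩ : L.direction)
    (by simpa [Subtype.ext_iff] using hne hiQ)).mp hL.2 ⟨_, hvj⟩
  have hr' : r • (toReal (p i) -ᵥ toReal (p Q)) = toReal (p j) -ᵥ toReal (p Q) :=
    congrArg Subtype.val hr
  have hr0 : r ≠ 0 := by
    rintro rfl
    rw [zero_smul] at hr'
    exact hne hjQ hr'.symm
  refine normalizeVec_eq_of_parallel (sub_ne_zero_of_injective hp hiQ) hr0 fun k => ?_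
  have := congrFun hr' k
  simp only [vsub_eq_sub, Pi.smul_apply, Pi.sub_apply, toReal, smul_eq_mul] at this
  push_cast
  exact this.symm

/-- If the line carries two given points, one of them serves as base point and all others share one
key of its table; with fewer points the bound is trivial. -/
theorem pointsOn_le_of_isLine {p : Fin N → Fin n → ℤ} (hp : Function.Injective p)
    {L : AffineSubspace ℝ (Fin n → ℝ)} (hL : IsLine L) {m : ℕ} (hm : ∀ Q, (mup p Q).val ≤ m) :
    pointsOn p L ≤ m + 1 := by
  classical
  set S : Set (Fin N) := {i | toReal (p i) ∈ L} with hS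
  change S.ncard ≤ m + 1
  rcases S.subsingleton_or_nontrivial with h | h
  · exact (Set.ncard_le_one_iff_subsingleton.mpr h).trans (Nat.le_add_left 1 m)
  · obtain ⟨Q, hQ, i, hi, hne⟩ := h
    have hsub : S ⊆ ↑(insert Q (Finset.univ.filter fun j => j ≠ Q ∧ dir p Q j = dir p Q i)) := by
      intro j hj
      rw [Finset.mem_coe, Finset.mem_insert, Finset.mem_filter_univ]
      by_cases hjQ : j = Q
      · exact Or.inl hjQ
      · exact Or.inr ⟨hjQ, dir_eq_of_mem_line hp hL hQ hj hi hjQ hne.symm⟩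
    refine (Set.ncard_le_ncard hsub (Finset.finite_toSet _)).trans ?_
    rw [Set.ncard_coe_finset]
    refine (Finset.card_insert_le _ _).trans (Nat.add_le_add_right ?_ 1)
    exact (dirCount_le_mup p Q (dir p Q i)).trans (hm Q)

theorem isLine_lineOf (P : Fin n → ℤ) {V : Fin n → ℤ} (hV : V ≠ 0) : IsLine (lineOf P V) := by
  refine ⟨⟨toReal P, AffineSubspace.self_mem_mk' _ _⟩, ?_⟩
  rw [lineOf, AffineSubspace.direction_mk']
  refine finrank_span_singleton fun h0 => hV (funext fun k => ?_)
  have := congrFun h0 k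
  simp only [toReal, Pi.zero_apply] at this
  exact_mod_cast this

theorem isMaxLine_of_mup_maximal {p : Fin N → Fin n → ℤ} (hp : Function.Injective p)
    (hN : 2 ≤ N) {P : Fin N} (hP : ∀ Q, (mup p Q).val ≤ (mup p P).val) :
    IsMaxLine p (lineOf (p P) (mupKey p P).val) := by
  have : Nontrivial (Fin N) := Fin.nontrivial_iff_two_le.mpr hN
  obtain ⟨Q, hQ⟩ := exists_ne P
  obtain ⟨h1, h2⟩ := dirCount_mupKey p hQ
  refine ⟨isLine_lineOf _ ?_, fun L hL => ?_⟩
  -- The key is the direction to some other point `i`; if it were zero, `p i` would equal `p P`.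
  · obtain ⟨i, hi⟩ := Finset.card_pos.mp (h2.trans_eq h1.symm)
    obtain ⟨hiP, hdir⟩ := (Finset.mem_filter_univ i).mp hi
    intro h0
    rw [h0] at hdir
    refine sub_ne_zero_of_injective hp hiP (funext fun k => ?_)
    have := eq_mul_normalizeVec (sub_ne_zero_of_injective hp hiP) k
    rw [show (normalizeVec fun k => p i k - p P k).val = 0 from hdir] at this
    simpa using this
  · refine (pointsOn_le_of_isLine hp hL hP).trans ?_
    rw [← h1]
    exact pointsOn_lineOf_ge hp P _

end Lines

/-! ## The algorithm *maxpoints* -/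

section Main

variable {N n : ℕ}

/-- The function that *maxpoints* minimizes. -/
def negMup (p : Fin N → Fin n → ℤ) (i : Fin N) : Timed ℤ := do
  let c ← mup p i
  tick 1
  return -(c : ℤ)

theorem negMup_val (p : Fin N → Fin n → ℤ) (i : Fin N) :
    (negMup p i).val = -((mup p i).val : ℤ) := rfl

theorem negMup_time (p : Fin N → Fin n → ℤ) (i : Fin N) :
    (negMup p i).time = (mup p i).time + (1 + 0) := rfl

theorem minfindUnit_negMup_le {p : Fin N → Fin n → ℤ} {U : ℕ} (hp : ∀ i k, |p i k| ≤ (U : ℤ))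
    (hN : 2 ≤ N) (hn : 1 ≤ n) (hU : 2 ≤ U) :
    minfindUnit (negMup p) ≤ 120 * (N * n * Nat.size (2 * U)) := by
  have hL : 1 ≤ Nat.size (2 * U) := Nat.size_pos.mpr (by omega)
  have hNn : N ≤ N * n := Nat.le_mul_of_pos_right N hn
  have hNnL : N * n ≤ N * n * Nat.size (2 * U) := Nat.le_mul_of_pos_right _ hL
  have hW : worstTime (negMup p) ≤ 52 * (N * n * Nat.size (2 * U)) + 2 := by
    refine Finset.sup_le fun i _ => ?_
    have := directionTable_findMax_time_le hp i hN hn hU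
    rw [negMup_time, mup_time]
    omega
  have hR : registerCost (Fin N) ≤ N := registerCost_fin_le (by omega)
  unfold minfindUnit
  -- With `X = N n L ≥ 1`: `2 (52 X + 2) + 3 X + 9 = 107 X + 13 ≤ 120 X`.
  omega

variable [NeZero N]

theorem maxpoints_eq (ε : ℝ) (p : Fin N → Fin n → ℤ) :
    maxpoints ε p = minfind ε (negMup p) >>= fun P => run (mupKey p P) >>= fun V =>
      run (tick n) >>= fun _ => pure (p P, V) := rfl

/-- After *minfind* everything is deterministic, and a minimizer of `negMup` always yields a best
line. -/
theorem failureProbability_maxpoints_le {ε : ℝ} (h0 : 0 < ε) (h1 : ε ≤ 1 / 2)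
    {p : Fin N → Fin n → ℤ} (hp : Function.Injective p) (hN : 2 ≤ N) :
    failureProbability (maxpoints ε p) (fun o => IsMaxLine p (lineOf o.1 o.2)) ≤
      ENNReal.ofReal ε := by
  classical
  rw [failureProbability_eq_expect, maxpoints_eq]
  simp only [expect_bind, expect_run, expect_pure]
  refine le_trans (expect_mono _ fun P => ?_) (expect_minfind_failure_le h0 h1 (negMup p))
  split_ifs with h h' h'
  · exact le_rfl
  · exact zero_le
  · refine absurd (isMaxLine_of_mup_maximal hp hN fun Q => ?_) h
    have := h' Q
    rw [negMup_val, negMup_val] at this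
    omega
  · exact le_rfl

/-- `2U` has at most `2 + lg U` binary digits, and `lg U ≥ 1`. -/
theorem size_two_mul_le {U : ℕ} (hU : 2 ≤ U) : (Nat.size (2 * U) : ℝ) ≤ 3 * Real.logb 2 U := by
  have hU0 : (0 : ℝ) < U := by positivity
  have h1 : 1 ≤ Real.logb 2 U := by
    rw [Real.le_logb_iff_rpow_le one_lt_two hU0, Real.rpow_one]
    exact_mod_cast hU
  have hs : 0 < Nat.size (2 * U) := Nat.size_pos.mpr (by omega)
  obtain ⟨m, hm⟩ := Nat.exists_eq_succ_of_ne_zero hs.ne'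
  have h2 : 2 ^ m ≤ 2 * U := Nat.lt_size.mp (by omega)
  have h3 : (m : ℝ) ≤ 1 + Real.logb 2 U := by
    have h4 : (m : ℝ) ≤ Real.logb 2 (2 * U) := by
      rw [Real.le_logb_iff_rpow_le one_lt_two (by positivity), Real.rpow_natCast]
      exact_mod_cast h2
    rwa [Real.logb_mul two_ne_zero hU0.ne', Real.logb_self_eq_one one_lt_two] at h4
  rw [hm]
  push_cast
  linarith

theorem expectedTime_maxpoints_le {ε : ℝ} (h0 : 0 < ε) (h1 : ε ≤ 1 / 2)
    {p : Fin N → Fin n → ℤ} {U : ℕ} (hp : ∀ i k, |p i k| ≤ (U : ℤ))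
    (hN : 2 ≤ N) (hn : 1 ≤ n) (hU : 2 ≤ U) :
    expectedTime (maxpoints ε p) ≤
      ENNReal.ofReal (200000 * (N : ℝ) ^ (3 / 2 : ℝ) * n * Real.logb 2 U *
        Real.sqrt (Real.logb 2 ε⁻¹)) := by
  set L := Nat.size (2 * U) with hLdef
  have hL : 1 ≤ L := Nat.size_pos.mpr (by omega)
  have hNn : n ≤ N * n := Nat.le_mul_of_pos_left n (by omega)
  have hNnL : N * n ≤ N * n * L := Nat.le_mul_of_pos_right _ hL
  have hrest : ∀ P : Fin N, ((mupKey p P).time : ℝ≥0∞) + ((n : ℕ) : ℝ≥0∞) ≤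
      ENNReal.ofReal (54 * (N * n * L)) := by
    intro P
    have h := directionTable_findMax_time_le hp P hN hn hU
    have h' : (mupKey p P).time + n ≤ 54 * (N * n * L) := by
      rw [mupKey_time]
      rw [← hLdef] at h
      omega
    rw [show (54 * (N * n * L) : ℝ) = ((54 * (N * n * L) : ℕ) : ℝ) by push_cast; ring,
      ENNReal.ofReal_natCast]
    exact_mod_cast h'
  have htime : expectedTime (maxpoints ε p) ≤
      ENNReal.ofReal (232 * Real.sqrt (N * logInv ε) * minfindUnit (negMup p)) +
        ENNReal.ofReal (54 * (N * n * L)) := by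
    rw [maxpoints_eq, expectedTime_bind]
    simp only [expectedTime_bind, expectedTime_run, expect_run, expectedTime_pure, add_zero,
      tick_time]
    refine add_le_add ?_ (expect_le_const _ hrest)
    have := expectedTime_minfind_le h0 h1 (negMup p)
    rwa [Fintype.card_fin] at this
  refine htime.trans ?_
  rw [← ENNReal.ofReal_add (by positivity) (by positivity)]
  refine ENNReal.ofReal_le_ofReal ?_
  have hunit : (minfindUnit (negMup p) : ℝ) ≤ 120 * (N * n * L) := by
    exact_mod_cast minfindUnit_negMup_le hp hN hn hU
  have hlog := one_le_logb_inv h0 h1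
  set l := Real.logb 2 ε⁻¹ with hl
  have hN1 : (1 : ℝ) ≤ N := by exact_mod_cast (by omega : 1 ≤ N)
  -- Rounding up gives at most `l + 1 ≤ 2l`; the cruder `4l` has a convenient square root.
  have ht : (logInv ε : ℝ) ≤ 4 * l := by
    have := Nat.ceil_lt_add_one (show 0 ≤ Real.logb 2 ε⁻¹ by linarith)
    change (⌈Real.logb 2 ε⁻¹⌉₊ : ℝ) ≤ _
    linarith
  have hsqrt : Real.sqrt (N * logInv ε) ≤ 2 * (Real.sqrt N * Real.sqrt l) := by
    calc Real.sqrt (N * logInv ε) ≤ Real.sqrt (2 ^ 2 * (N * l)) := by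
          refine Real.sqrt_le_sqrt ?_
          nlinarith
      _ = _ := by
          rw [Real.sqrt_mul (by norm_num), Real.sqrt_sq (by norm_num), Real.sqrt_mul (by linarith)]
  have hA1 : 1 ≤ Real.sqrt N * Real.sqrt l :=
    one_le_mul_of_one_le_of_one_le (Real.one_le_sqrt.mpr hN1) (Real.one_le_sqrt.mpr hlog)
  have hpow : (N : ℝ) ^ (3 / 2 : ℝ) = N * Real.sqrt N := by
    rw [show (3 / 2 : ℝ) = 1 + 1 / 2 by norm_num, Real.rpow_add (by linarith), Real.rpow_one,
      Real.sqrt_eq_rpow]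
  set A := Real.sqrt N * Real.sqrt l with hA
  set X : ℝ := N * n * L with hX
  have hX0 : 0 ≤ X := by positivity
  have hXle : X ≤ N * n * (3 * Real.logb 2 U) := by
    rw [hX]
    gcongr
    exact size_two_mul_le hU
  calc 232 * Real.sqrt (N * logInv ε) * minfindUnit (negMup p) + 54 * X
      ≤ 232 * (2 * A) * (120 * X) + 54 * (A * X) := by
        gcongr
        exact le_mul_of_one_le_left hX0 hA1
    -- `232 · 2 · 120 + 54 = 55734`.
    _ ≤ 60000 * A * X := by nlinarith [mul_nonneg (zero_le_one.trans hA1) hX0]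
    _ ≤ 60000 * A * (N * n * (3 * Real.logb 2 U)) := by gcongr
    _ = 180000 * ((N * Real.sqrt N) * n * Real.logb 2 U * Real.sqrt l) := by rw [hA]; ring
    _ ≤ 200000 * ((N * Real.sqrt N) * n * Real.logb 2 U * Real.sqrt l) := by
        refine mul_le_mul_of_nonneg_right (by norm_num) ?_
        have : 0 ≤ Real.logb 2 U := Real.logb_nonneg one_lt_two (by exact_mod_cast (by omega))
        positivity
    _ = _ := by rw [hpow]; ring

end Main

end Maxpoints

theorem theorem9 :
    ∃ C : ℝ, 0 < C ∧
      ∀ (N n U : ℕ) [NeZero N] (p : Fin N → Fin n → ℤ) (ε : ℝ),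
        2 ≤ N → 2 ≤ U → Function.Injective p → (∀ i k, |p i k| ≤ (U : ℤ)) →
        0 < ε → ε ≤ 1 / 2 →
        Maxpoints.failureProbability (Maxpoints.maxpoints ε p)
            (fun o => Maxpoints.IsMaxLine p (Maxpoints.lineOf o.1 o.2)) ≤ ENNReal.ofReal ε ∧
        Maxpoints.expectedTime (Maxpoints.maxpoints ε p) ≤
          ENNReal.ofReal
            (C * (N : ℝ) ^ (3 / 2 : ℝ) * n * Real.logb 2 U * Real.sqrt (Real.logb 2 ε⁻¹)) := by
  refine ⟨200000, by norm_num, fun N n U _ p ε hN hU hp hpU h0 h1 => ?_⟩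
  refine ⟨Maxpoints.failureProbability_maxpoints_le h0 h1 hp hN,
    Maxpoints.expectedTime_maxpoints_le h0 h1 hpU hN ?_ hU⟩
  rcases Nat.eq_zero_or_pos n with rfl | hn
  -- Dimension zero is impossible: `ℤ⁰` has a single point, but there are two distinct ones.
  · have : Nontrivial (Fin N) := Fin.nontrivial_iff_two_le.mpr hN
    obtain ⟨i, j, hij⟩ := exists_pair_ne (Fin N)
    exact absurd (hp (Subsingleton.elim _ _)) hij
  · exact hn
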